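/- Algebras are over fields and are not assumed to be unital, commutative or associative. Let $\mathfrak V$ be one of the following three varieties: all algebras, associative algebras (not necessarily with unit), Lie algebras. For a field $F$ and a set $X$ let $\mathcal F_F(X)$ be the free algebra of $\mathfrak V$ over $F$ on the set $X$. Let $A$ be an algebra over a field $K$ belonging to $\mathfrak V$. An identity of $A$ is an element $p\in\mathcal F_K(\{x_1,x_2,\dots\})$ with $\varphi(p)=0$ for all $K$-algebra homomorphisms $\varphi:\mathcal F_K(\{x_1,x_2,\dots\})\to A$; it is nontrivial if $p\neq 0$. For an ultrafilter $\mathscr U$ on a set $I$ let $K^{\mathscr U}$ and $A^{\mathscr U}$ be the ultrapowers, so that $A^{\mathscr U}$ is an algebra over $K$ and over the field $K^{\mathscr U}$. An algebra $B$ over a field $L$ is called elementarily equivalent to $A$ if the pairs (field, algebra) $(K,A)$ and $(L,B)$ satisfy the same first-order sentences of the two-sorted language having the ring operations $0,1,+,-,\cdot$ on scalars, the operations $0,+,-,\cdot$ on the algebra, and the multiplication of algebra elements by scalars. Then the following conditions are equivalent: 1. $A$ satisfies no nontrivial identity. 2. Any free algebra embeds in an ultrapower of $A$. Precisely, each of the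 following two versions is equivalent to 1: - (2a) for every set $X$ there is an ultrafilter $\mathscr U$ on some set and an injective $K$-algebra homomorphism $\mathcal F_K(X)\to A^{\mathscr U}$; - (2b) for every set $X$ there is an ultrafilter $\mathscr U$ on some set and an injective $K^{\mathscr U}$-algebra homomorphism $\mathcal F_{K^{\mathscr U}}(X)\to A^{\mathscr U}$. 3. Any free algebra embeds in an algebra elementarily equivalent to $A$. Precisely, each of the following two versions is equivalent to 1: - (3a) for every set $X$ there are a field $L$, an $L$-algebra $B$ elementarily equivalent to $A$, a field embedding $\sigma:K\to L$ and an injective ring homomorphism $f:\mathcal F_K(X)\to B$ with $f(cu)=\sigma(c)f(u)$ for $c\in K$, $u\in\mathcal F_K(X)$; - (3b) for every set $X$ there are a field $L$, an $L$-algebra $B$ elementarily equivalent to $A$, and an injective $L$-algebra homomorphism $\mathcal F_L(X)\to B$. -/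

import Mathlib

universe u v w

namespace AlgIdent

noncomputable section

/-! ### The three varieties and their free algebras

Algebras over a commutative ring `R` are not assumed to be associative, commutative or unital:
they are types `A` with `[NonUnitalNonAssocRing A] [Module R A] [IsScalarTower R A A]
[SMulCommClass R A A]`. -/

/-- Names for the varieties of all algebras, of associative algebras and of Lie algebras. -/
inductive Variety
  | all
  | assoc
  | lie

/-- The (coefficient-free) laws that cut out each of the three varieties. The product of a Lie
algebra is its bracket. -/
def Variety.Contains (V : Variety) (A : Type v) [NonUnitalNonAssocRing A] : Prop :=
  match V with
  | .all => True
  | .assoc => ∀ x y z : A, (x * y) * z = x * (y * z)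
  | .lie => (∀ x : A, x * x = 0) ∧ ∀ x y z : A, x * (y * z) + y * (z * x) + z * (x * y) = 0

/-- The free algebra on the set `X` over `R` in the variety `V`: the magma algebra of the free
magma, the semigroup algebra of the free semigroup (so, without unit), and the free Lie algebra
with the bracket as product. -/
def FreeAlg (V : Variety) (R : Type u) [CommRing R] (X : Type w) : Type (max u w) :=
  match V with
  | .all => FreeNonUnitalNonAssocAlgebra R X
  | .assoc => MonoidAlgebra R (FreeSemigroup X)
  | .lie => CommutatorRing (FreeLieAlgebra R X)

namespace FreeAlg

variable (V : Variety) (R : Type u) [CommRing R] (X : Type w)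

instance instNonUnitalNonAssocRing : NonUnitalNonAssocRing (FreeAlg V R X) :=
  match V with
  | .all => inferInstanceAs (NonUnitalNonAssocRing (FreeNonUnitalNonAssocAlgebra R X))
  | .assoc => inferInstanceAs (NonUnitalNonAssocRing (MonoidAlgebra R (FreeSemigroup X)))
  | .lie => inferInstanceAs (NonUnitalNonAssocRing (CommutatorRing (FreeLieAlgebra R X)))

instance instModule : Module R (FreeAlg V R X) :=
  match V with
  | .all => inferInstanceAs (Module R (FreeNonUnitalNonAssocAlgebra R X))
  | .assoc => inferInstanceAs (Module R (MonoidAlgebra R (FreeSemigroup X)))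
  | .lie => inferInstanceAs (Module R (CommutatorRing (FreeLieAlgebra R X)))

instance instIsScalarTower : IsScalarTower R (FreeAlg V R X) (FreeAlg V R X) :=
  match V with
  | .all => inferInstanceAs (IsScalarTower R (FreeNonUnitalNonAssocAlgebra R X)
      (FreeNonUnitalNonAssocAlgebra R X))
  | .assoc => inferInstanceAs (IsScalarTower R (MonoidAlgebra R (FreeSemigroup X))
      (MonoidAlgebra R (FreeSemigroup X)))
  | .lie => inferInstanceAs (IsScalarTower R (CommutatorRing (FreeLieAlgebra R X))
      (CommutatorRing (FreeLieAlgebra R X)))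

instance instSMulCommClass : SMulCommClass R (FreeAlg V R X) (FreeAlg V R X) :=
  match V with
  | .all => inferInstanceAs (SMulCommClass R (FreeNonUnitalNonAssocAlgebra R X)
      (FreeNonUnitalNonAssocAlgebra R X))
  | .assoc => inferInstanceAs (SMulCommClass R (MonoidAlgebra R (FreeSemigroup X))
      (MonoidAlgebra R (FreeSemigroup X)))
  | .lie => inferInstanceAs (SMulCommClass R (CommutatorRing (FreeLieAlgebra R X))
      (CommutatorRing (FreeLieAlgebra R X)))

variable {X}

/-- The free generators. -/
def of (x : X) : FreeAlg V R X :=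
  match V with
  | .all => FreeNonUnitalNonAssocAlgebra.of R x
  | .assoc => MonoidAlgebra.ofMagma R (FreeSemigroup X) (FreeSemigroup.of x)
  | .lie => FreeLieAlgebra.of R x

/-- The free algebra of a variety belongs to the variety. -/
theorem contains : V.Contains (FreeAlg V R X) := by
  cases V with
  | all => trivial
  | assoc => exact fun x y z : MonoidAlgebra R (FreeSemigroup X) => mul_assoc x y z
  | lie =>
    exact ⟨fun x : FreeLieAlgebra R X => lie_self x,
      fun x y z : FreeLieAlgebra R X => lie_jacobi x y z⟩

/-- The universal property of the free algebra within its variety. -/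
theorem existsUnique_lift {A : Type v} [NonUnitalNonAssocRing A] [Module R A]
    [IsScalarTower R A A] [SMulCommClass R A A] (hA : V.Contains A) (f : X → A) :
    ∃! φ : FreeAlg V R X →ₙₐ[R] A, ∀ x, φ (of V R x) = f x := by
  cases V with
  | all =>
    refine ⟨FreeNonUnitalNonAssocAlgebra.lift R f,
      FreeNonUnitalNonAssocAlgebra.lift_of_apply R f, fun ψ hψ => ?_⟩
    exact FreeNonUnitalNonAssocAlgebra.hom_ext R fun x =>
      (hψ x).trans (FreeNonUnitalNonAssocAlgebra.lift_of_apply R f x).symm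
  | assoc =>
    have hassoc : ∀ x y z : A, x * y * z = x * (y * z) := hA
    let _ : NonUnitalRing A := { ‹NonUnitalNonAssocRing A› with mul_assoc := hassoc }
    refine ⟨MonoidAlgebra.liftMagma R (FreeSemigroup.lift f), fun x => ?_, fun ψ hψ => ?_⟩
    · change (((MonoidAlgebra.liftMagma R).symm
        (MonoidAlgebra.liftMagma R (FreeSemigroup.lift f))) (FreeSemigroup.of x) : A) = f x
      rw [Equiv.symm_apply_apply]
      simp
    · apply (MonoidAlgebra.liftMagma R (A := A)).symm.injective
      rw [Equiv.symm_apply_apply]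
      apply FreeSemigroup.hom_ext
      funext x
      exact (hψ x).trans (by simp)
  | lie =>
    obtain ⟨hsq, hjac⟩ : (∀ x : A, x * x = 0) ∧
        ∀ x y z : A, x * (y * z) + y * (z * x) + z * (x * y) = 0 := hA
    have hskew : ∀ x y : A, x * y = -(y * x) := fun x y => by
      have h := hsq (x + y)
      rw [add_mul, mul_add, mul_add, hsq x, hsq y, zero_add, add_zero] at h
      exact eq_neg_of_add_eq_zero_left h
    let _ : LieRing A :=
      { (inferInstance : AddCommGroup A) with
        bracket := fun x y => x * y
        add_lie := add_mul
        lie_add := mul_add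
        lie_self := hsq
        leibniz_lie := fun x y z => by
          change x * (y * z) = (x * y) * z + y * (x * z)
          have h := hjac x y z
          rw [hskew z x, mul_neg, hskew z (x * y)] at h
          rw [← sub_eq_zero]
          rw [← h]
          abel }
    let _ : LieAlgebra R A :=
      { (inferInstance : Module R A) with lie_smul := fun t x y => mul_smul_comm t x y }
    let φ := FreeLieAlgebra.lift R f
    let φ' : CommutatorRing (FreeLieAlgebra R X) →ₙₐ[R] A :=
      { toFun := φ, map_smul' := φ.map_smul, map_zero' := φ.map_zero,
        map_add' := φ.map_add, map_mul' := φ.map_lie }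
    refine ⟨φ',
      FreeLieAlgebra.lift_of_apply f, fun ψ hψ => ?_⟩
    let ψ' : FreeLieAlgebra R X →ₗ⁅R⁆ A :=
      { toFun := ψ, map_add' := map_add ψ, map_smul' := map_smul ψ,
        map_lie' := fun {x y} => ψ.map_mul' x y }
    have h : ψ' = φ := (FreeLieAlgebra.lift_unique f ψ').1 (funext hψ)
    ext x
    exact congrArg (fun g : FreeLieAlgebra R X →ₗ⁅R⁆ A => g x) h

end FreeAlg

/-- `A` satisfies no nontrivial identity within the variety `V`. An identity of `A` is an element
`p` of the free algebra on countably many generators, with coefficients in the ground ring, all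
of whose evaluations in `A` vanish. -/
def NoNontrivialIdentity (V : Variety) (R : Type u) [CommRing R] (A : Type v)
    [NonUnitalNonAssocRing A] [Module R A] : Prop :=
  ∀ p : FreeAlg V R ℕ, (∀ φ : FreeAlg V R ℕ →ₙₐ[R] A, φ p = 0) → p = 0

/-! ### The first-order two-sorted theory of pairs (field, algebra over the field) -/

/-- Terms of the scalar sort, in scalar variables `0, …, m - 1`. -/
inductive ScalarTerm (m : ℕ) : Type
  | var (i : Fin m)
  | zero
  | one
  | add (s t : ScalarTerm m)
  | neg (t : ScalarTerm m)
  | mul (s t : ScalarTerm m)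

/-- Terms of the algebra sort, in scalar variables `0, …, m - 1` and algebra variables
`0, …, n - 1`. -/
inductive VectorTerm (m n : ℕ) : Type
  | var (i : Fin n)
  | zero
  | add (s t : VectorTerm m n)
  | neg (t : VectorTerm m n)
  | mul (s t : VectorTerm m n)
  | smul (c : ScalarTerm m) (t : VectorTerm m n)

/-- Two-sorted first-order formulas whose free variables are among the scalar variables
`0, …, m - 1` and the algebra variables `0, …, n - 1`. A quantifier binds the last variable of its
sort; the other connectives and the existential quantifiers are definable as usual. -/
inductive TwoSortedFormula : ℕ → ℕ → Type
  | eqScalar {m n : ℕ} (s t : ScalarTerm m) : TwoSortedFormula m n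
  | eqVector {m n : ℕ} (s t : VectorTerm m n) : TwoSortedFormula m n
  | falsum {m n : ℕ} : TwoSortedFormula m n
  | imp {m n : ℕ} (φ ψ : TwoSortedFormula m n) : TwoSortedFormula m n
  | allScalar {m n : ℕ} (φ : TwoSortedFormula (m + 1) n) : TwoSortedFormula m n
  | allVector {m n : ℕ} (φ : TwoSortedFormula m (n + 1)) : TwoSortedFormula m n

/-- The value of a scalar term. -/
def ScalarTerm.eval {K : Type u} [Field K] {m : ℕ} (a : Fin m → K) : ScalarTerm m → K
  | .var i => a i
  | .zero => 0
  | .one => 1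
  | .add s t => s.eval a + t.eval a
  | .neg t => -t.eval a
  | .mul s t => s.eval a * t.eval a

/-- The value of a term of the algebra sort. -/
def VectorTerm.eval {K : Type u} [Field K] {A : Type v} [NonUnitalNonAssocRing A] [Module K A]
    {m n : ℕ} (a : Fin m → K) (x : Fin n → A) : VectorTerm m n → A
  | .var i => x i
  | .zero => 0
  | .add s t => s.eval a x + t.eval a x
  | .neg t => -t.eval a x
  | .mul s t => s.eval a x * t.eval a x
  | .smul c t => c.eval a • t.eval a x

/-- Truth of a formula in the pair `(K, A)` under an assignment of its free variables. -/
def TwoSortedFormula.Realize {K : Type u} [Field K] {A : Type v} [NonUnitalNonAssocRing A]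
    [Module K A] : {m n : ℕ} → TwoSortedFormula m n → (Fin m → K) → (Fin n → A) → Prop
  | _, _, .eqScalar s t, a, _ => s.eval a = t.eval a
  | _, _, .eqVector s t, a, x => s.eval a x = t.eval a x
  | _, _, .falsum, _, _ => False
  | _, _, .imp φ ψ, a, x => φ.Realize a x → ψ.Realize a x
  | _, _, .allScalar φ, a, x => ∀ c : K, φ.Realize (Fin.snoc a c : Fin (_ + 1) → K) x
  | _, _, .allVector φ, a, x => ∀ y : A, φ.Realize a (Fin.snoc x y : Fin (_ + 1) → A)

/-- The `K`-algebra `A` and the `L`-algebra `B` are elementarily equivalent: the pairs `(K, A)` and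
`(L, B)` satisfy the same sentences of the two-sorted theory. -/
def ElementarilyEquivalent (K : Type*) [Field K] (A : Type*) [NonUnitalNonAssocRing A]
    [Module K A] (L : Type*) [Field L] (B : Type*) [NonUnitalNonAssocRing B] [Module L B] : Prop :=
  ∀ φ : TwoSortedFormula 0 0,
    φ.Realize (Fin.elim0 : Fin 0 → K) (Fin.elim0 : Fin 0 → A) ↔
      φ.Realize (Fin.elim0 : Fin 0 → L) (Fin.elim0 : Fin 0 → B)

end

end AlgIdent

open AlgIdent

/-! The coefficients of an identity are removed from the problem: every free algebra is spanned by
the values of integer nonassociative polynomials at its generators, and such polynomials can be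
evaluated in any ring, whatever the ground field.

The core is `NoIntegerIdentity.exists_linearIndependent`: if every integer polynomial vanishing on
`A` is zero in the free algebra over `K`, then finitely many integer polynomials that are
`K`-independent in a free algebra take `K`-independent values at some point of `A`. A single
polynomial is the hypothesis. For more, one chooses an expression that is linear in `u` and vanishes
at `u = v` (`alternant`), with a fresh variable `y`, and replaces `p_0, ..., p_n` by the alternants
of `p_i` with `p_n` for `i < n`. In the free algebra the only `u` killed are the multiples of `v`
(`mem_span_of_alternant_eq_zero`), so independence survives, and independence of the alternants at a
point of `A` forces that of the `p_i`.

Condition 1 is therefore the absence of integer identities. Given it, the sets of points of `A^X`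
where a finite part of an integer basis has independent values generate a proper filter. In the
ultrapower for an ultrafilter containing them, the germs of the coordinates generate a free algebra,
over `K` and over the ultrapower of `K` alike. The theorem of Łoś then gives the elementary
versions.

Conversely, an integer identity is a first-order sentence, hence passes from `A` to `B` and to a
free algebra embedded in `B`. If that free algebra is over `L`, one returns to `K` because vanishing
of an integer polynomial in a free algebra depends only on which integers vanish in the field
(`eval_of_eq_zero_iff`). For Lie algebras this, and the detection of dependence, rest on the
embedding of the free Lie algebra in the free associative one. -/

namespace FreeLieAlgebra

attribute [local instance 100] LieRing.ofAssociativeRing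

/-! ### The free Lie algebra inside the free associative algebra, by elimination of letters. -/

section Embedding

variable (R : Type u) [CommRing R]

/-- The canonical map from the free Lie algebra to the free associative algebra. -/
noncomputable def toFreeAlgebra (X : Type w) : FreeLieAlgebra R X →ₗ⁅R⁆ FreeAlgebra R X :=
  lift R (FreeAlgebra.ι R)

variable {R} {X : Type w}

@[simp]
theorem toFreeAlgebra_of (x : X) : toFreeAlgebra R X (of R x) = FreeAlgebra.ι R x :=
  lift_of_apply _ x

/-- The multiset of letters of a nonassociative monomial. -/
def letters : FreeMagma X → Multiset X
  | .of x => {x}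
  | .mul s t => letters s + letters t

theorem letters_ne_zero (t : FreeMagma X) : letters t ≠ 0 := by
  induction t with
  | ih1 x => exact Multiset.singleton_ne_zero x
  | ih2 s t hs ht => exact fun h => hs (add_eq_zero.1 h).1

variable (R) in
/-- The value of a bracket monomial in the free Lie algebra. -/
noncomputable def monomial : FreeMagma X → FreeLieAlgebra R X
  | .of x => of R x
  | .mul s t => ⁅monomial s, monomial t⁆

variable (R) in
/-- The span of the bracket monomials of a given multidegree. -/
noncomputable def multidegreePart (α : Multiset X) : Submodule R (FreeLieAlgebra R X) :=
  Submodule.span R {w | ∃ t, letters t = α ∧ monomial R t = w}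

theorem monomial_mem (t : FreeMagma X) : monomial R t ∈ multidegreePart R (letters t) :=
  Submodule.subset_span ⟨t, rfl, rfl⟩

variable (R X) in
/-- The homomorphism recording the multidegree of the words in the free algebra. -/
noncomputable def multidegreeHom :
    FreeAlgebra R X →ₐ[R] AddMonoidAlgebra (FreeAlgebra R X) (Multiset X) :=
  FreeAlgebra.lift R fun x => AddMonoidAlgebra.single {x} (FreeAlgebra.ι R x)

theorem multidegreeHom_of_mem {α : Multiset X} {w : FreeLieAlgebra R X}
    (hw : w ∈ multidegreePart R α) :
    multidegreeHom R X (toFreeAlgebra R X w) =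
      AddMonoidAlgebra.single α (toFreeAlgebra R X w) := by
  induction hw using Submodule.span_induction with
  | mem w hw =>
    obtain ⟨t, rfl, rfl⟩ := hw
    induction t with
    | ih1 x => simp [monomial, letters, multidegreeHom]
    | ih2 s t hs ht =>
      change multidegreeHom R X (toFreeAlgebra R X ⁅monomial R s, monomial R t⁆) =
        AddMonoidAlgebra.single (letters s + letters t)
          (toFreeAlgebra R X ⁅monomial R s, monomial R t⁆)
      simp only [LieHom.map_lie, LieRing.of_associative_ring_bracket, map_sub,
        map_mul, hs, ht, AddMonoidAlgebra.single_mul_single, AddMonoidAlgebra.single_sub]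
      rw [add_comm (letters t)]
  | zero => simp
  | add v w _ _ hv hw => simp [hv, hw, AddMonoidAlgebra.single_add]
  | smul c w _ hw => simp [hw, AddMonoidAlgebra.smul_single]

/-- `multidegreeHom` separates the images of the different multidegrees, so injectivity can be
tested one multidegree at a time. Directness of the sum of the multidegree parts is not needed. -/
theorem eq_zero_of_mem_iSup {ι : Type*} {m : ι → Multiset X} (hm : Function.Injective m)
    (h : ∀ i, ∀ w ∈ multidegreePart R (m i), toFreeAlgebra R X w = 0 → w = 0)
    {w : FreeLieAlgebra R X} (hw : w ∈ ⨆ i, multidegreePart R (m i))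
    (h0 : toFreeAlgebra R X w = 0) : w = 0 := by
  obtain ⟨f, hf, rfl⟩ := (Submodule.mem_iSup_iff_exists_finsupp _ _).1 hw
  refine Finset.sum_eq_zero fun i _ => h i _ (hf i) ?_
  have h1 := congrArg (multidegreeHom R X) h0
  rw [map_zero, Finsupp.sum, map_sum, map_sum] at h1
  simp only [multidegreeHom_of_mem (hf _)] at h1
  have h2 := congrArg (fun p => p.coeff (m i)) h1
  classical
  simp [Finsupp.single_apply, hm.eq_iff] at h2
  by_cases hi : f i = 0
  · simp [hi]
  · simpa using h2 hi

variable (R X) in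
/-- The span of the bracket monomials of a given length. -/
noncomputable def lengthPart (n : ℕ) : Submodule R (FreeLieAlgebra R X) :=
  Submodule.span R {w | ∃ t, (letters t).card = n ∧ monomial R t = w}

theorem lengthPart_le (n : ℕ) :
    lengthPart R X n ≤ ⨆ α : {α : Multiset X // α.card = n}, multidegreePart R α.1 := by
  refine Submodule.span_le.2 ?_
  rintro _ ⟨t, ht, rfl⟩
  exact Submodule.mem_iSup_of_mem (⟨letters t, ht⟩ : {α : Multiset X // α.card = n})
    (monomial_mem t)

theorem lie_mem_lengthPart {m n : ℕ} {v w : FreeLieAlgebra R X} (hv : v ∈ lengthPart R X m)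
    (hw : w ∈ lengthPart R X n) : ⁅v, w⁆ ∈ lengthPart R X (m + n) := by
  induction hv using Submodule.span_induction with
  | mem v hv =>
    obtain ⟨s, rfl, rfl⟩ := hv
    induction hw using Submodule.span_induction with
    | mem w hw =>
      obtain ⟨t, rfl, rfl⟩ := hw
      exact Submodule.subset_span ⟨s.mul t, Multiset.card_add _ _, rfl⟩
    | zero => simp
    | add w w' _ _ h h' => rw [lie_add]; exact add_mem h h'
    | smul c w _ h => rw [lie_smul]; exact Submodule.smul_mem _ _ h
  | zero => simp
  | add v v' _ _ h h' => rw [add_lie]; exact add_mem h h'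
  | smul c v _ h => rw [smul_lie]; exact Submodule.smul_mem _ _ h

theorem iSup_multidegreePart_eq_top : ⨆ α : Multiset X, multidegreePart R α = ⊤ := by
  have hmem (t : FreeMagma X) : monomial R t ∈ ⨆ α : Multiset X, multidegreePart R α :=
    Submodule.mem_iSup_of_mem _ (monomial_mem t)
  have hle : (⨆ α : Multiset X, multidegreePart R α) =
      Submodule.span R (Set.range (monomial R : FreeMagma X → _)) := by
    refine le_antisymm (iSup_le fun α => Submodule.span_mono ?_) (Submodule.span_le.2 ?_)
    · rintro _ ⟨t, -, rfl⟩
      exact ⟨t, rfl⟩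
    · rintro _ ⟨t, rfl⟩
      exact hmem t
  rw [hle]
  let S : LieSubalgebra R (FreeLieAlgebra R X) :=
    { Submodule.span R (Set.range (monomial R : FreeMagma X → _)) with
      lie_mem' := fun {v w} hv hw => by
        simp only [AddSubsemigroup.mem_carrier, AddSubmonoid.mem_toSubsemigroup,
          Submodule.mem_toAddSubmonoid] at hv hw ⊢
        induction hv using Submodule.span_induction with
        | mem v hv =>
          obtain ⟨s, rfl⟩ := hv
          induction hw using Submodule.span_induction with
          | mem w hw =>
            obtain ⟨t, rfl⟩ := hw
            exact Submodule.subset_span ⟨s.mul t, rfl⟩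
          | zero => simp
          | add w w' _ _ h h' => rw [lie_add]; exact add_mem h h'
          | smul c w _ h => rw [lie_smul]; exact Submodule.smul_mem _ _ h
        | zero => simp
        | add v v' _ _ h h' => rw [add_lie]; exact add_mem h h'
        | smul c v _ h => rw [smul_lie]; exact Submodule.smul_mem _ _ h }
  have hS : S.incl.comp (lift R fun x => (⟨of R x, Submodule.subset_span ⟨.of x, rfl⟩⟩ : S)) =
      LieHom.id := by
    ext x
    simp
  refine eq_top_iff.2 fun w _ => ?_
  have h := congrArg (fun g : FreeLieAlgebra R X →ₗ⁅R⁆ FreeLieAlgebra R X => g w) hS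
  simp only [LieHom.comp_apply, LieHom.id_apply] at h
  rw [← h]
  exact Subtype.prop (p := fun w => w ∈ S) _

/-- The letters other than `x`, together with their iterated brackets with `x`. -/
abbrev ElimLetters (x : X) := ℕ × {y : X // y ≠ x}

variable (R) in
/-- The homomorphism sending `(n, y)` to `(ad x)^n y`. -/
noncomputable def elimHom (x : X) : FreeLieAlgebra R (ElimLetters x) →ₗ⁅R⁆ FreeLieAlgebra R X :=
  lift R fun p => (fun w => ⁅of R x, w⁆)^[p.1] (of R p.2.1)

/-- Bracketing with `x` lifts to the derivation that raises the first index of a letter: by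
construction on letters, by the Leibniz rule on brackets. The length is kept, as the later induction
on the degree requires. -/
theorem exists_elimHom_eq_lie_monomial (x : X) (s : FreeMagma (ElimLetters x)) :
    ∃ u ∈ lengthPart R (ElimLetters x) (letters s).card,
      elimHom R x u = ⁅of R x, elimHom R x (monomial R s)⁆ := by
  induction s with
  | ih1 p =>
    refine ⟨monomial R (.of (p.1 + 1, p.2)),
      Submodule.subset_span ⟨.of (p.1 + 1, p.2), rfl, rfl⟩, ?_⟩
    change elimHom R x (of R (p.1 + 1, p.2)) = ⁅of R x, elimHom R x (of R p)⁆
    simp [elimHom, Function.iterate_succ_apply']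
  | ih2 s t hs ht =>
    obtain ⟨u, hu, hu'⟩ := hs
    obtain ⟨v, hv, hv'⟩ := ht
    have hcard : (letters (s * t)).card = (letters s).card + (letters t).card :=
      Multiset.card_add _ _
    refine ⟨⁅u, monomial R t⁆ + ⁅monomial R s, v⁆, ?_, ?_⟩
    · rw [hcard]
      exact add_mem (lie_mem_lengthPart hu (Submodule.subset_span ⟨t, rfl, rfl⟩))
        (lie_mem_lengthPart (Submodule.subset_span ⟨s, rfl, rfl⟩) hv)
    · change _ = ⁅of R x, elimHom R x ⁅monomial R s, monomial R t⁆⁆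
      rw [map_add, LieHom.map_lie, LieHom.map_lie, LieHom.map_lie, hu', hv', ← leibniz_lie]

theorem exists_elimHom_eq_lie (x : X) {n : ℕ} {w : FreeLieAlgebra R (ElimLetters x)}
    (hw : w ∈ lengthPart R (ElimLetters x) n) :
    ∃ u ∈ lengthPart R (ElimLetters x) n, elimHom R x u = ⁅of R x, elimHom R x w⁆ := by
  induction hw using Submodule.span_induction with
  | mem w hw =>
    obtain ⟨s, rfl, rfl⟩ := hw
    exact exists_elimHom_eq_lie_monomial x s
  | zero => exact ⟨0, zero_mem _, by simp⟩
  | add v w _ _ hv hw =>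
    obtain ⟨u, hu, hu'⟩ := hv
    obtain ⟨u', hu₁, hu₂⟩ := hw
    exact ⟨u + u', add_mem hu hu₁, by simp [hu', hu₂]⟩
  | smul c w _ hw =>
    obtain ⟨u, hu, hu'⟩ := hw
    exact ⟨c • u, Submodule.smul_mem _ _ hu, by simp [hu']⟩

-- Of the monomials in `x` alone only `x` itself can be nonzero, since `⁅x, x⁆ = 0`. Any other
-- monomial is a combination of brackets of elements `(ad x)^n y`, with one such factor for each
-- letter different from `x`.
open Classical in
theorem monomial_mem_elim (x : X) (t : FreeMagma X) :
    ((letters t).countP (· ≠ x) = 0 ∧ (monomial R t = of R x ∨ monomial R t = 0)) ∨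
      ((letters t).countP (· ≠ x) ≠ 0 ∧ ∃ u ∈ lengthPart R (ElimLetters x)
        ((letters t).countP (· ≠ x)), elimHom R x u = monomial R t) := by
  induction t with
  | ih1 y =>
    by_cases hy : y = x
    · left
      subst hy
      refine ⟨?_, Or.inl rfl⟩
      change ({y} : Multiset X).countP (· ≠ y) = 0
      simp [Multiset.countP_eq_card_filter, Multiset.filter_singleton]
    · right
      have h1 : (letters (FreeMagma.of y)).countP (· ≠ x) = 1 := by
        change ({y} : Multiset X).countP (· ≠ x) = 1
        simp [Multiset.countP_eq_card_filter, Multiset.filter_singleton, hy]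
      rw [h1]
      refine ⟨one_ne_zero, of R (0, ⟨y, hy⟩),
        Submodule.subset_span ⟨.of (0, ⟨y, hy⟩), Multiset.card_singleton _, rfl⟩, ?_⟩
      change elimHom R x (of R (0, ⟨y, hy⟩)) = of R y
      simp [elimHom]
  | ih2 s t hs ht =>
    have hc : (letters (s * t)).countP (· ≠ x) =
        (letters s).countP (· ≠ x) + (letters t).countP (· ≠ x) := Multiset.countP_add _ _ _
    have hm : monomial R (s * t) = ⁅monomial R s, monomial R t⁆ := rfl
    rw [hc, hm]
    rcases hs with ⟨hs, hs'⟩ | ⟨hs, u, hu, hu'⟩ <;> rcases ht with ⟨ht, ht'⟩ | ⟨ht, v, hv, hv'⟩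
    · left
      refine ⟨by rw [hs, ht], Or.inr ?_⟩
      rcases hs' with hs' | hs' <;> rcases ht' with ht' | ht' <;> simp [hs', ht']
    · right
      rw [hs, zero_add, ← hv']
      refine ⟨ht, ?_⟩
      rcases hs' with hs' | hs'
      · rw [hs']
        exact exists_elimHom_eq_lie x hv
      · exact ⟨0, zero_mem _, by simp [hs']⟩
    · right
      rw [ht, add_zero, ← hu']
      refine ⟨hs, ?_⟩
      rcases ht' with ht' | ht'
      · obtain ⟨v, hv, hv'⟩ := exists_elimHom_eq_lie x hu
        exact ⟨-v, neg_mem hv, by rw [ht', map_neg, hv', lie_skew]⟩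
      · exact ⟨0, zero_mem _, by simp [ht']⟩
    · right
      exact ⟨by omega, ⁅u, v⁆, lie_mem_lengthPart hu hv, by rw [LieHom.map_lie, hu', hv']⟩

open Classical in
theorem mem_elim_of_mem_multidegreePart (x : X) {α : Multiset X} {w : FreeLieAlgebra R X}
    (hw : w ∈ multidegreePart R α) :
    (∃ c : R, w = c • of R x) ∨
      ∃ u ∈ lengthPart R (ElimLetters x) (α.countP (· ≠ x)), elimHom R x u = w := by
  by_cases hα : α.countP (· ≠ x) = 0
  · left
    induction hw using Submodule.span_induction with
    | mem w hw =>
      obtain ⟨t, rfl, rfl⟩ := hw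
      rcases monomial_mem_elim (R := R) x t with ⟨-, h | h⟩ | ⟨h, -⟩
      · exact ⟨1, by simp [h]⟩
      · exact ⟨0, by simp [h]⟩
      · exact absurd hα h
    | zero => exact ⟨0, by simp⟩
    | add v w _ _ hv hw =>
      obtain ⟨c, rfl⟩ := hv
      obtain ⟨d, rfl⟩ := hw
      exact ⟨c + d, by rw [add_smul]⟩
    | smul c w _ hw =>
      obtain ⟨d, rfl⟩ := hw
      exact ⟨c * d, by rw [mul_smul]⟩
  · right
    have hle : multidegreePart R α ≤
        (lengthPart R (ElimLetters x) (α.countP (· ≠ x))).map (elimHom R x).toLinearMap := by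
      refine Submodule.span_le.2 ?_
      rintro _ ⟨t, rfl, rfl⟩
      rcases monomial_mem_elim (R := R) x t with ⟨h, -⟩ | ⟨-, h⟩
      · exact absurd h hα
      · exact h
    exact hle hw

section Shift

variable (R) (Y : Type w)

/-- The homomorphism `a ↦ a + ε δ a`, where `δ` is the derivation raising the first index of a
letter by one. -/
noncomputable def shiftHom : FreeAlgebra R (ℕ × Y) →ₐ[R] DualNumber (FreeAlgebra R (ℕ × Y)) :=
  FreeAlgebra.lift R fun p =>
    TrivSqZeroExt.inl (FreeAlgebra.ι R p) + TrivSqZeroExt.inr (FreeAlgebra.ι R (p.1 + 1, p.2))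

theorem fst_shiftHom (a : FreeAlgebra R (ℕ × Y)) : (shiftHom R Y a).fst = a := by
  have h : (TrivSqZeroExt.fstHom R (FreeAlgebra R (ℕ × Y)) (FreeAlgebra R (ℕ × Y))).comp
      (shiftHom R Y) = AlgHom.id R _ := by
    ext p
    simp [shiftHom]
  exact congrArg (fun g : FreeAlgebra R (ℕ × Y) →ₐ[R] FreeAlgebra R (ℕ × Y) => g a) h

/-- The derivation raising the first index of a letter by one. -/
noncomputable def shiftDeriv : Module.End R (FreeAlgebra R (ℕ × Y)) :=
  (TrivSqZeroExt.sndHom (FreeAlgebra R (ℕ × Y)) (FreeAlgebra R (ℕ × Y))).restrictScalars R ∘ₗ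
    (shiftHom R Y).toLinearMap

/-- This is the Leibniz rule for the shift derivation, read off from the second component of a
product of dual numbers. -/
theorem lie_shiftDeriv_mulLeft (p : ℕ × Y) :
    ⁅shiftDeriv R Y, LinearMap.mulLeft R (FreeAlgebra.ι R p)⁆ =
      LinearMap.mulLeft R (FreeAlgebra.ι R (p.1 + 1, p.2)) := by
  ext a
  have h : (shiftHom R Y (FreeAlgebra.ι R p)).snd = FreeAlgebra.ι R (p.1 + 1, p.2) := by
    simp [shiftHom]
  simp [LieRing.of_associative_ring_bracket, shiftDeriv, fst_shiftHom, h]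

end Shift

open Classical in
variable (R) in
/-- The representation of the free algebra on `X` in which `x` acts by the shift derivation and the
other letters act by left multiplication. -/
noncomputable def elimRep (x : X) :
    FreeAlgebra R X →ₐ[R] Module.End R (FreeAlgebra R (ElimLetters x)) :=
  FreeAlgebra.lift R fun y =>
    if h : y = x then shiftDeriv R _ else LinearMap.mulLeft R (FreeAlgebra.ι R (0, ⟨y, h⟩))

/-- Each commutator with the shift derivation raises an index, so `(ad x)^n y` acts as left
multiplication by the letter `(n, y)`. Both sides are Lie homomorphisms in `u`, so the letters
suffice. -/
theorem elimRep_elimHom (x : X) (u : FreeLieAlgebra R (ElimLetters x)) :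
    elimRep R x (toFreeAlgebra R X (elimHom R x u)) =
      LinearMap.mulLeft R (toFreeAlgebra R (ElimLetters x) u) := by
  have h : ((elimRep R x).toLieHom.comp (toFreeAlgebra R X)).comp (elimHom R x) =
      (Algebra.lmul R (FreeAlgebra R (ElimLetters x))).toLieHom.comp
        (toFreeAlgebra R (ElimLetters x)) := by
    ext1 ⟨n, y⟩
    have h1 : elimRep R x (FreeAlgebra.ι R x) = shiftDeriv R _ := by simp [elimRep]
    have h2 : elimRep R x (FreeAlgebra.ι R y.1) = LinearMap.mulLeft R (FreeAlgebra.ι R (0, y)) := by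
      simp [elimRep, y.2]
    change elimRep R x (toFreeAlgebra R X (elimHom R x (of R (n, y)))) =
      LinearMap.mulLeft R (toFreeAlgebra R _ (of R (n, y)))
    rw [toFreeAlgebra_of, elimHom, lift_of_apply]
    dsimp only
    induction n with
    | zero => simpa using h2
    | succ n ih =>
      rw [Function.iterate_succ_apply', LieHom.map_lie, toFreeAlgebra_of,
        LieRing.of_associative_ring_bracket, map_sub, map_mul, map_mul, ih, h1,
        ← LieRing.of_associative_ring_bracket, lie_shiftDeriv_mulLeft]
  exact congrArg (fun g : FreeLieAlgebra R _ →ₗ⁅R⁆ Module.End R _ => g u) h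

/-- Eliminating a letter `x` of `α` lowers the degree to the number of letters other than `x`, but
changes the alphabet; hence the strong induction is over all alphabets at once. -/
theorem eq_zero_of_mem_multidegreePart (n : ℕ) : ∀ {X : Type w} (α : Multiset X), α.card = n →
    ∀ w ∈ multidegreePart R α, toFreeAlgebra R X w = 0 → w = 0 := by
  induction n using Nat.strong_induction_on with
  | _ n ih =>
    intro X α hα w hw h0
    rcases Multiset.empty_or_exists_mem α with rfl | ⟨x, hx⟩
    · have h : multidegreePart R (0 : Multiset X) ≤ ⊥ := by
        refine Submodule.span_le.2 ?_
        rintro _ ⟨t, ht, rfl⟩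
        exact absurd ht (letters_ne_zero t)
      exact h hw
    · classical
      rcases mem_elim_of_mem_multidegreePart x hw with ⟨c, rfl⟩ | ⟨u, hu, rfl⟩
      -- Sending every letter to `1` recovers the coefficient `c`.
      · have h1 := congrArg (FreeAlgebra.lift R fun _ => (1 : R)) h0
        simp only [map_smul, toFreeAlgebra_of, FreeAlgebra.lift_ι_apply, map_zero, smul_eq_mul,
          mul_one] at h1
        rw [h1, zero_smul]
      · have hlt : α.countP (· ≠ x) < n := by
          rw [← hα]
          refine lt_of_le_of_ne (Multiset.countP_le_card _ _) fun h => ?_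
          exact Multiset.countP_eq_card.1 h x hx rfl
        have h1 : toFreeAlgebra R _ u = 0 := by
          have h2 := elimRep_elimHom x u
          rw [h0, map_zero] at h2
          -- Left multiplication by an element, applied to `1`, returns the element.
          have h3 := congrArg (fun g : Module.End R _ => g 1) h2
          simpa using h3.symm
        rw [eq_zero_of_mem_iSup Subtype.val_injective
          (fun β v hv => ih _ hlt β.1 β.2 v hv) (lengthPart_le _ hu) h1, map_zero]

variable (R X) in
/-- The free Lie algebra embeds in the free associative algebra. -/
theorem toFreeAlgebra_injective : Function.Injective (toFreeAlgebra R X) := by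
  rw [injective_iff_map_eq_zero]
  intro w hw
  refine eq_zero_of_mem_iSup (m := id) Function.injective_id
    (fun α v hv => eq_zero_of_mem_multidegreePart _ α rfl v hv) ?_ hw
  have h := iSup_multidegreePart_eq_top (R := R) (X := X)
  simp only [id_eq, h, Submodule.mem_top]

end Embedding

end FreeLieAlgebra

/-! ### Integer polynomials and their values. -/

namespace AlgIdent

attribute [local instance 100] LieRing.ofAssociativeRing

/-- Nonassociative polynomials with integer coefficients. -/
abbrev IntPoly (X : Type w) := FreeNonUnitalNonAssocAlgebra ℤ X

namespace IntPoly

variable {X : Type w} {A : Type v} [NonUnitalNonAssocRing A]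

/-- The value of an integer polynomial in a nonassociative ring. -/
noncomputable def eval (a : X → A) : IntPoly X →ₙₐ[ℤ] A :=
  FreeNonUnitalNonAssocAlgebra.lift ℤ a

@[simp]
theorem eval_of (a : X → A) (x : X) : eval a (FreeNonUnitalNonAssocAlgebra.of ℤ x) = a x :=
  FreeNonUnitalNonAssocAlgebra.lift_of_apply _ _ _

@[elab_as_elim]
theorem induction {P : IntPoly X → Prop} (p : IntPoly X)
    (of : ∀ x, P (FreeNonUnitalNonAssocAlgebra.of ℤ x)) (zero : P 0)
    (add : ∀ p q, P p → P q → P (p + q)) (neg : ∀ p, P p → P (-p))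
    (mul : ∀ p q, P p → P q → P (p * q)) : P p := by
  have hm (t : FreeMagma X) : P (MonoidAlgebra.single t 1) := by
    induction t with
    | ih1 x => exact of x
    | ih2 s t hs ht => simpa [MonoidAlgebra.single_mul_single] using mul _ _ hs ht
  have hn (t : FreeMagma X) (n : ℕ) : P (MonoidAlgebra.single t (n : ℤ)) := by
    induction n with
    | zero => simpa using zero
    | succ n ih => simpa [MonoidAlgebra.single_add] using add _ _ ih (hm t)
  induction p using MonoidAlgebra.induction_linear with
  | zero => exact zero
  | add p q hp hq => exact add _ _ hp hq
  | single t n =>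
    obtain ⟨m, rfl | rfl⟩ := n.eq_nat_or_neg
    · exact hn t m
    · simpa [MonoidAlgebra.single_neg] using neg _ (hn t m)

theorem map_eval {B F : Type*} [NonUnitalNonAssocRing B] [FunLike F A B]
    [NonUnitalRingHomClass F A B] (g : F) (a : X → A) (p : IntPoly X) :
    g (eval a p) = eval (fun x => g (a x)) p := by
  induction p using induction with
  | of x => simp
  | zero => simp
  | add p q hp hq => simp [hp, hq]
  | neg p hp => simp [hp]
  | mul p q hp hq => simp [hp, hq]

/-- The value of an integer polynomial depends on finitely many variables only. -/
theorem exists_finset_eval_congr (A : Type v) [NonUnitalNonAssocRing A] (p : IntPoly X) :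
    ∃ S : Finset X, ∀ a b : X → A, (∀ x ∈ S, a x = b x) → eval a p = eval b p := by
  classical
  induction p using induction with
  | of x => exact ⟨{x}, fun a b h => by simpa using h⟩
  | zero => exact ⟨∅, fun a b h => by simp⟩
  | add p q hp hq =>
    obtain ⟨S, hS⟩ := hp
    obtain ⟨T, hT⟩ := hq
    exact ⟨S ∪ T, fun a b h => by
      rw [map_add, map_add, hS a b fun x hx => h x (Finset.mem_union_left _ hx),
        hT a b fun x hx => h x (Finset.mem_union_right _ hx)]⟩
  | neg p hp =>
    obtain ⟨S, hS⟩ := hp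
    exact ⟨S, fun a b h => by rw [map_neg, map_neg, hS a b h]⟩
  | mul p q hp hq =>
    obtain ⟨S, hS⟩ := hp
    obtain ⟨T, hT⟩ := hq
    exact ⟨S ∪ T, fun a b h => by
      rw [map_mul, map_mul, hS a b fun x hx => h x (Finset.mem_union_left _ hx),
        hT a b fun x hx => h x (Finset.mem_union_right _ hx)]⟩

end IntPoly

theorem Variety.Contains.subalgebra {V : Variety} {R : Type u} [CommRing R] {A : Type v}
    [NonUnitalNonAssocRing A] [Module R A] (hA : V.Contains A) (S : NonUnitalSubalgebra R A) :
    V.Contains S := by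
  cases V with
  | all => trivial
  | assoc => exact fun x y z => Subtype.ext (hA x.1 y.1 z.1)
  | lie => exact ⟨fun x => Subtype.ext (hA.1 x.1), fun x y z => Subtype.ext (hA.2 x.1 y.1 z.1)⟩

/-! ### Spanning sets and associative embeddings of the free algebras. -/

namespace FreeAlg

variable {V : Variety} {R : Type u} [CommRing R] {X : Type w}

section Lift

variable {A : Type v} [NonUnitalNonAssocRing A] [Module R A] [IsScalarTower R A A]
  [SMulCommClass R A A]

/-- The homomorphism from the free algebra with given values on the generators. -/
noncomputable def lift (hA : V.Contains A) (f : X → A) : FreeAlg V R X →ₙₐ[R] A :=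
  (existsUnique_lift V R hA f).choose

@[simp]
theorem lift_of (hA : V.Contains A) (f : X → A) (x : X) : lift hA f (of V R x) = f x :=
  (existsUnique_lift V R hA f).choose_spec.1 x

end Lift

/-- Lifting the generators into `S` and including back is the identity, by uniqueness in the
universal property. -/
theorem subalgebra_eq_top (S : NonUnitalSubalgebra R (FreeAlg V R X))
    (hS : ∀ x, of V R x ∈ S) (p : FreeAlg V R X) : p ∈ S := by
  let φ : FreeAlg V R X →ₙₐ[R] S :=
    lift ((contains V R (X := X)).subalgebra S) fun x => ⟨of V R x, hS x⟩
  have h := (existsUnique_lift V R (contains V R (X := X)) (of V R)).unique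
    (y₁ := (NonUnitalSubalgebraClass.subtype S).comp φ) (y₂ := NonUnitalAlgHom.id R _)
    (fun x => by simp [φ]) (fun x => rfl)
  have h1 : (φ p : FreeAlg V R X) = p := DFunLike.congr_fun h p
  rw [← h1]
  exact (φ p).2

@[elab_as_elim]
theorem induction {P : FreeAlg V R X → Prop} (p : FreeAlg V R X) (of : ∀ x, P (of V R x))
    (zero : P 0) (add : ∀ p q, P p → P q → P (p + q)) (smul : ∀ (c : R) p, P p → P (c • p))
    (mul : ∀ p q, P p → P q → P (p * q)) : P p :=
  let S : NonUnitalSubalgebra R (FreeAlg V R X) :=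
    { carrier := {p | P p}
      zero_mem' := zero
      add_mem' := fun hp hq => add _ _ hp hq
      smul_mem' := fun c _ hp => smul c _ hp
      mul_mem' := fun hp hq => mul _ _ hp hq }
  subalgebra_eq_top S of p

/-- The free algebra is spanned by the values of integer polynomials at the generators. -/
theorem span_range_eval :
    Submodule.span R (Set.range (IntPoly.eval (of V R) : IntPoly X → FreeAlg V R X)) = ⊤ := by
  refine eq_top_iff.2 fun p _ => ?_
  induction p using induction with
  | of x => exact Submodule.subset_span ⟨FreeNonUnitalNonAssocAlgebra.of ℤ x, by simp⟩
  | zero => exact zero_mem _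
  | add p q hp hq => exact add_mem (hp trivial) (hq trivial)
  | smul c p hp => exact Submodule.smul_mem _ _ (hp trivial)
  | mul p q hp hq =>
    have hp := hp trivial
    have hq := hq trivial
    clear * - hp hq
    induction hp using Submodule.span_induction with
    | mem p hp =>
      obtain ⟨p, rfl⟩ := hp
      induction hq using Submodule.span_induction with
      | mem q hq =>
        obtain ⟨q, rfl⟩ := hq
        exact Submodule.subset_span ⟨p * q, map_mul _ _ _⟩
      | zero => simp
      | add q q' _ _ h h' => rw [mul_add]; exact add_mem h h'
      | smul c q _ h => rw [mul_smul_comm]; exact Submodule.smul_mem _ _ h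
    | zero => simp
    | add p p' _ _ h h' => rw [add_mul]; exact add_mem h h'
    | smul c p _ h => rw [smul_mul_assoc]; exact Submodule.smul_mem _ _ h

variable (R X) in
/-- The embedding of the free nonunital associative algebra in the free unital one. -/
noncomputable def assocHom : FreeAlg .assoc R X →ₙₐ[R] FreeAlgebra R X :=
  MonoidAlgebra.liftMagma R (FreeSemigroup.lift (FreeAlgebra.ι R))

theorem assocHom_of (x : X) : assocHom R X (of .assoc R x) = FreeAlgebra.ι R x := by
  change MonoidAlgebra.liftMagma R (FreeSemigroup.lift (FreeAlgebra.ι R))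
    (MonoidAlgebra.single (FreeSemigroup.of x) 1) = _
  simp

/-- In terms of monoid algebras the map is induced by the inclusion of nonempty words in all words.
-/
theorem assocHom_injective : Function.Injective (assocHom R X) := by
  have hinj : Function.Injective (FreeSemigroup.lift (FreeMonoid.of : X → FreeMonoid X)) := by
    have h (s : FreeSemigroup X) :
        (FreeSemigroup.lift (FreeMonoid.of : X → FreeMonoid X) s).toList = s.head :: s.tail := by
      induction s using FreeSemigroup.recOnMul with
      | ih1 x => simp
      | ih2 x y _ hy => simp [hy]
    intro s t hst
    have h1 := congrArg FreeMonoid.toList hst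
    rw [h, h] at h1
    exact FreeSemigroup.ext (List.cons.inj h1).1 (List.cons.inj h1).2
  have hcomp (p : FreeAlg .assoc R X) : FreeAlgebra.equivMonoidAlgebraFreeMonoid (assocHom R X p) =
      MonoidAlgebra.mapDomain (FreeSemigroup.lift (FreeMonoid.of : X → FreeMonoid X))
        (p : MonoidAlgebra R (FreeSemigroup X)) := by
    induction p using induction with
    | of x =>
      rw [assocHom_of]
      change _ = MonoidAlgebra.mapDomain _ (MonoidAlgebra.single (FreeSemigroup.of x) 1)
      simp [FreeAlgebra.equivMonoidAlgebraFreeMonoid]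
    | zero => rw [map_zero, map_zero]; exact (MonoidAlgebra.mapDomain_zero _).symm
    | add p q hp hq => rw [map_add, map_add, hp, hq]; exact (MonoidAlgebra.mapDomain_add _ _ _).symm
    | smul c p hp =>
      rw [map_smul, map_smul, hp]
      exact (MonoidAlgebra.mapDomain_smul _ _ _).symm
    | mul p q hp hq => rw [map_mul, map_mul, hp, hq]; exact (MonoidAlgebra.mapDomain_mul _ _ _).symm
  intro p q hpq
  have h := congrArg FreeAlgebra.equivMonoidAlgebraFreeMonoid hpq
  rw [hcomp, hcomp] at h
  exact MonoidAlgebra.mapDomain_injective hinj h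

variable (R X) in
/-- The embedding of the free Lie algebra in the commutator algebra of the free associative
algebra. -/
noncomputable def lieHom : FreeAlg .lie R X →ₙₐ[R] CommutatorRing (FreeAlgebra R X) :=
  (FreeLieAlgebra.toFreeAlgebra R X).toNonUnitalAlgHom

theorem lieHom_of (x : X) : lieHom R X (of .lie R x) = FreeAlgebra.ι R x :=
  FreeLieAlgebra.toFreeAlgebra_of x

theorem lieHom_injective : Function.Injective (lieHom R X) :=
  FreeLieAlgebra.toFreeAlgebra_injective R X

end FreeAlg

/-! ### Independence of the ground field -/

/-- Reduction of integer coefficients to a commutative ring. -/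
noncomputable def castMonoidAlgebra (R : Type u) [CommRing R] (G : Type w) [Mul G] :
    MonoidAlgebra ℤ G →ₙₐ[ℤ] MonoidAlgebra R G :=
  MonoidAlgebra.liftMagma ℤ (MonoidAlgebra.ofMagma R G)

theorem castMonoidAlgebra_single (R : Type u) [CommRing R] (G : Type w) [Mul G] (g : G) (n : ℤ) :
    castMonoidAlgebra R G (MonoidAlgebra.single g n) = MonoidAlgebra.single g (n : R) := by
  simp [castMonoidAlgebra]

theorem coeff_castMonoidAlgebra (R : Type u) [CommRing R] {G : Type w} [Mul G]
    (p : MonoidAlgebra ℤ G) (g : G) : (castMonoidAlgebra R G p).coeff g = (p.coeff g : R) := by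
  classical
  induction p using MonoidAlgebra.induction_linear with
  | zero => simp
  | add p q hp hq => simp [hp, hq]
  | single h n => simp [castMonoidAlgebra_single, Finsupp.single_apply]

/-- A homomorphism of associative rings preserves commutators. -/
def commutatorMap {A : Type u} {B : Type v} [Ring A] [Ring B] (f : A →ₙ+* B) :
    CommutatorRing A →ₙ+* CommutatorRing B where
  toFun := f
  map_zero' := f.map_zero
  map_add' := f.map_add
  map_mul' (a b : A) := by
    change f (a * b - b * a) = f a * f b - f b * f a
    rw [map_sub, map_mul, map_mul]

namespace FreeAlg

/-- The words that index the coefficients of the elements of a free algebra. -/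
def Word (V : Variety) (X : Type w) : Type w :=
  match V with
  | .all => FreeMagma X
  | .assoc => FreeSemigroup X
  | .lie => FreeMonoid X

variable (R : Type u) [CommRing R] {X : Type w}

/-- A free generator as an element of the associative monoid algebra with its commutator. -/
noncomputable def commutatorOf (x : X) : CommutatorRing (MonoidAlgebra R (FreeMonoid X)) :=
  (MonoidAlgebra.single (FreeMonoid.of x) 1 : MonoidAlgebra R (FreeMonoid X))

/-- The integer coefficients of the value of an integer polynomial at the free generators. -/
noncomputable def coeffs (V : Variety) (p : IntPoly X) : Word V X → ℤ :=
  match V with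
  | .all => (IntPoly.eval (of .all ℤ) p : MonoidAlgebra ℤ (FreeMagma X)).coeff
  | .assoc => (IntPoly.eval (of .assoc ℤ) p : MonoidAlgebra ℤ (FreeSemigroup X)).coeff
  | .lie => (IntPoly.eval (commutatorOf ℤ) p : MonoidAlgebra ℤ (FreeMonoid X)).coeff

theorem castMonoidAlgebra_eq_zero_iff {G : Type w} [Mul G] (p : MonoidAlgebra ℤ G) :
    castMonoidAlgebra R G p = 0 ↔ ∀ g, (p.coeff g : R) = 0 := by
  refine ⟨fun h g => ?_, fun h => ?_⟩
  · rw [← coeff_castMonoidAlgebra, h]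
    simp
  · ext g
    rw [coeff_castMonoidAlgebra, h g]
    simp

/-- The value over `R` is the reduction of the value over the integers, coefficient by coefficient.
In the Lie case there are no words to index a basis directly, so the comparison takes place in the
free associative algebra, where injectivity of `lieHom` loses nothing. -/
theorem eval_of_eq_zero_iff (V : Variety) (p : IntPoly X) :
    IntPoly.eval (of V R) p = 0 ↔ ∀ g, (coeffs V p g : R) = 0 := by
  cases V with
  | all =>
    refine Iff.trans ?_ (castMonoidAlgebra_eq_zero_iff R
      (IntPoly.eval (of .all ℤ) p : MonoidAlgebra ℤ (FreeMagma X)))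
    have hx (x : X) : castMonoidAlgebra R (FreeMagma X) (of .all ℤ x) = of .all R x :=
      (castMonoidAlgebra_single R _ (FreeMagma.of x) 1).trans (by rw [Int.cast_one]; rfl)
    have h := (IntPoly.map_eval (castMonoidAlgebra R (FreeMagma X))
      (fun x => (of .all ℤ x : MonoidAlgebra ℤ (FreeMagma X))) p).trans
      (congrArg (fun a : X → MonoidAlgebra R (FreeMagma X) => IntPoly.eval a p) (funext hx))
    exact (congrArg (· = 0) h).symm.to_iff
  | assoc =>
    refine Iff.trans ?_ (castMonoidAlgebra_eq_zero_iff R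
      (IntPoly.eval (of .assoc ℤ) p : MonoidAlgebra ℤ (FreeSemigroup X)))
    have hx (x : X) : castMonoidAlgebra R (FreeSemigroup X) (of .assoc ℤ x) = of .assoc R x :=
      (castMonoidAlgebra_single R _ (FreeSemigroup.of x) 1).trans (by rw [Int.cast_one]; rfl)
    have h := (IntPoly.map_eval (castMonoidAlgebra R (FreeSemigroup X))
      (fun x => (of .assoc ℤ x : MonoidAlgebra ℤ (FreeSemigroup X))) p).trans
      (congrArg (fun a : X → MonoidAlgebra R (FreeSemigroup X) => IntPoly.eval a p) (funext hx))
    exact (congrArg (· = 0) h).symm.to_iff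
  | lie =>
    refine Iff.trans ?_ (castMonoidAlgebra_eq_zero_iff R
      (IntPoly.eval (commutatorOf ℤ) p : MonoidAlgebra ℤ (FreeMonoid X)))
    have h := IntPoly.map_eval (commutatorMap
      (castMonoidAlgebra R (FreeMonoid X) : MonoidAlgebra ℤ (FreeMonoid X) →ₙ+*
          MonoidAlgebra R (FreeMonoid X)))
      (commutatorOf ℤ) p
    have hx (x : X) : commutatorMap
        (castMonoidAlgebra R (FreeMonoid X) : MonoidAlgebra ℤ (FreeMonoid X) →ₙ+*
          MonoidAlgebra R (FreeMonoid X))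
        (commutatorOf ℤ x) = commutatorOf R x :=
      (castMonoidAlgebra_single R _ (FreeMonoid.of x) 1).trans (by rw [Int.cast_one]; rfl)
    simp only [hx] at h
    have h' := IntPoly.map_eval ((commutatorMap
      (FreeAlgebra.equivMonoidAlgebraFreeMonoid (R := R) (X := X) : FreeAlgebra R X →ₙ+*
        MonoidAlgebra R (FreeMonoid X))).comp
        (lieHom R X : FreeAlg .lie R X →ₙ+* CommutatorRing (FreeAlgebra R X))) (of .lie R) p
    have hx' (x : X) : (commutatorMap
      (FreeAlgebra.equivMonoidAlgebraFreeMonoid (R := R) (X := X) : FreeAlgebra R X →ₙ+*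
        MonoidAlgebra R (FreeMonoid X))).comp
        (lieHom R X : FreeAlg .lie R X →ₙ+* CommutatorRing (FreeAlgebra R X)) (of .lie R x) =
          commutatorOf R x := by
      change FreeAlgebra.equivMonoidAlgebraFreeMonoid (lieHom R X (of .lie R x)) = _
      rw [lieHom_of]
      simp [FreeAlgebra.equivMonoidAlgebraFreeMonoid, commutatorOf]
    simp only [hx'] at h'
    rw [← h] at h'
    change FreeAlgebra.equivMonoidAlgebraFreeMonoid
      (lieHom R X (IntPoly.eval (of .lie R) p)) = castMonoidAlgebra R (FreeMonoid X) _ at h'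
    rw [← h']
    exact ((map_eq_zero_iff _ FreeAlgebra.equivMonoidAlgebraFreeMonoid.injective).trans
      (map_eq_zero_iff _ lieHom_injective)).symm

end FreeAlg

end AlgIdent

namespace AlgIdent

open scoped TensorProduct

attribute [local instance 100] LieRing.ofAssociativeRing

/-! ### An alternating form detecting linear dependence -/

/-- A product expression that is linear and alternating in `u` and `v`. -/
def alternant (V : Variety) {A : Type v} [NonUnitalNonAssocRing A] (u v y : A) : A :=
  match V with
  | .all => (u * y) * (v * y) - (v * y) * (u * y)
  | .assoc => (u * y - y * u) * (v * y - y * v) - (v * y - y * v) * (u * y - y * u)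
  | .lie => (u * y) * (v * y)

section Alternant

variable (V : Variety) {A : Type v} [NonUnitalNonAssocRing A]

theorem alternant_self (hA : V.Contains A) (u y : A) : alternant V u u y = 0 := by
  cases V with
  | all => exact sub_self _
  | assoc => exact sub_self _
  | lie => exact hA.1 _

theorem alternant_zero_right (u y : A) : alternant V u 0 y = 0 := by
  cases V <;> simp [alternant]

theorem map_alternant {B F : Type*} [NonUnitalNonAssocRing B] [FunLike F A B]
    [NonUnitalRingHomClass F A B] (g : F) (u v y : A) :
    g (alternant V u v y) = alternant V (g u) (g v) (g y) := by
  cases V <;> simp [alternant]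

/-- The alternant as a linear map in its first argument. -/
def alternantLinear (R : Type u) [CommRing R] [Module R A] [IsScalarTower R A A]
    [SMulCommClass R A A] (v y : A) : A →ₗ[R] A where
  toFun u := alternant V u v y
  map_add' a b := by
    cases V
    · simp only [alternant, add_mul, mul_add]; abel
    · simp only [alternant, add_mul, mul_add, sub_mul, mul_sub]; abel
    · simp only [alternant, add_mul]
  map_smul' c a := by
    cases V <;> simp only [alternant, smul_mul_assoc, mul_smul_comm, smul_sub, RingHom.id_apply,
      mul_sub, sub_mul]

end Alternant

/-- Applying to the second factor a functional `f` with `f v ≠ 0` gives `f(v) u = f(u) v`. -/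
theorem mem_span_singleton_of_tmul_comm {K : Type u} [Field K] {W : Type v} [AddCommGroup W]
    [Module K W] {u v : W} (hv : v ≠ 0) (h : u ⊗ₜ[K] v = v ⊗ₜ[K] u) :
    u ∈ Submodule.span K {v} := by
  have hf : ∃ f : Module.Dual K W, f v ≠ 0 := by
    by_contra! hf
    exact hv ((Module.forall_dual_apply_eq_zero_iff K v).1 hf)
  obtain ⟨f, hf⟩ := hf
  have h1 := congrArg (fun t => TensorProduct.rid K W (f.lTensor W t)) h
  simp only [LinearMap.lTensor_tmul, TensorProduct.rid_tmul] at h1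
  refine Submodule.mem_span_singleton.2 ⟨(f v)⁻¹ * f u, ?_⟩
  rw [mul_smul, ← h1, smul_smul, inv_mul_cancel₀ hf, one_smul]

/-- A nonassociative algebra in which `(u * y) * (v * y)` determines the tensor `u ⊗ v`. -/
def TensorTarget (K : Type u) [Field K] (W : Type v) [NonUnitalNonAssocRing W] [Module K W] :
    Type (max u v) :=
  (W × K) × (W × (W ⊗[K] W))

namespace TensorTarget

variable (K : Type u) [Field K] (W : Type v) [NonUnitalNonAssocRing W] [Module K W]

instance : AddCommGroup (TensorTarget K W) :=
  inferInstanceAs (AddCommGroup ((W × K) × (W × (W ⊗[K] W))))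

instance : Module K (TensorTarget K W) :=
  inferInstanceAs (Module K ((W × K) × (W × (W ⊗[K] W))))

/-- The slots hold, in order, elements `w` of `W`, multiples of the symbol `y`, products `w * y`,
and products `(u * y) * (v * y)`, recorded as `u ⊗ v`. -/
instance : NonUnitalNonAssocRing (TensorTarget K W) :=
  { (inferInstance : AddCommGroup (TensorTarget K W)) with
    mul := fun a b => ((a.1.1 * b.1.1, 0), (b.1.2 • a.1.1, a.2.1 ⊗ₜ b.2.1))
    left_distrib := fun a b c => by
      refine Prod.ext (Prod.ext (mul_add _ _ _) (add_zero _).symm)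
        (Prod.ext (add_smul _ _ _) (TensorProduct.tmul_add _ _ _))
    right_distrib := fun a b c => by
      refine Prod.ext (Prod.ext (add_mul _ _ _) (add_zero _).symm)
        (Prod.ext (smul_add _ _ _) (TensorProduct.add_tmul _ _ _))
    zero_mul := fun a =>
      Prod.ext (Prod.ext (zero_mul _) rfl) (Prod.ext (smul_zero _) (TensorProduct.zero_tmul _ _))
    mul_zero := fun a =>
      Prod.ext (Prod.ext (mul_zero _) rfl) (Prod.ext (zero_smul _ _) (TensorProduct.tmul_zero _ _)) }

instance [IsScalarTower K W W] : IsScalarTower K (TensorTarget K W) (TensorTarget K W) :=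
  ⟨fun c a b => Prod.ext (Prod.ext (smul_mul_assoc c a.1.1 b.1.1) (smul_zero c).symm)
    (Prod.ext (smul_comm _ _ _) (TensorProduct.smul_tmul' c a.2.1 b.2.1))⟩

instance [SMulCommClass K W W] : SMulCommClass K (TensorTarget K W) (TensorTarget K W) :=
  ⟨fun c a b => Prod.ext (Prod.ext (mul_smul_comm c a.1.1 b.1.1).symm (smul_zero c))
    (Prod.ext (mul_smul _ _ _).symm (TensorProduct.tmul_smul c a.2.1 b.2.1).symm)⟩

end TensorTarget

namespace FreeAlg

variable (V : Variety) (K : Type u) [Field K]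

/-- The endomorphism of the free algebra on `ℕ` that shifts the generators by one. -/
noncomputable def shift : FreeAlg V K ℕ →ₙₐ[K] FreeAlg V K ℕ :=
  lift (contains V K) fun n => of V K (n + 1)

variable {K}

/-- The shift frees the generator `0` to play the role of `y`. Under `Φ` the alternant becomes `u ⊗
v - v ⊗ u`. -/
theorem mem_span_of_alternant_all {u v : FreeAlg .all K ℕ} (hv : v ≠ 0)
    (h : alternant .all (shift .all K u) (shift .all K v) (of .all K 0) = 0) :
    u ∈ Submodule.span K {v} := by
  let W := FreeAlg .all K ℕ
  let Φ : W →ₙₐ[K] TensorTarget K W := lift (V := .all) trivial fun n =>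
    n.casesOn ((0, 1), (0, 0)) fun n => ((of .all K n, 0), (0, 0))
  have hΦ (w : W) : Φ (shift .all K w) = ((w, 0), (0, 0)) := by
    induction w using induction with
    | of n => rw [shift, lift_of]; exact lift_of _ _ _
    | zero => rw [map_zero, map_zero]; rfl
    | add p q hp hq =>
      rw [map_add, map_add, hp, hq]
      exact Prod.ext (Prod.ext rfl (add_zero _)) (Prod.ext (add_zero _) (add_zero _))
    | smul c p hp =>
      rw [map_smul, map_smul, hp]
      exact Prod.ext (Prod.ext rfl (smul_zero _)) (Prod.ext (smul_zero _) (smul_zero _))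
    | mul p q hp hq =>
      rw [map_mul, map_mul, hp, hq]
      exact Prod.ext (Prod.ext rfl rfl)
        (Prod.ext (zero_smul _ _) (TensorProduct.zero_tmul _ _))
  have h0 : Φ (of .all K 0) = ((0, 1), (0, 0)) := lift_of _ _ _
  have h1 := congrArg Φ h
  rw [map_alternant, hΦ, hΦ, h0, map_zero] at h1
  have h2 : ((1 : K) • u) ⊗ₜ[K] ((1 : K) • v) - ((1 : K) • v) ⊗ₜ[K] ((1 : K) • u) = 0 :=
    congrArg (fun t : TensorTarget K W => t.2.2) h1
  rw [one_smul, one_smul] at h2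
  exact mem_span_singleton_of_tmul_comm hv (sub_eq_zero.1 h2)

section SepMatrix

variable {T : Type v} [Ring T] [Algebra K T]

variable (K) in
/-- The diagonal matrix with entries `a ⊗ 1`, `0`, `1 ⊗ a`. -/
def sepMatrix (a : T) : Matrix (Fin 3) (Fin 3) (T ⊗[K] T) :=
  !![a ⊗ₜ 1, 0, 0; 0, 0, 0; 0, 0, 1 ⊗ₜ a]

theorem sepMatrix_zero : sepMatrix K (0 : T) = 0 := by
  ext i j
  fin_cases i <;> fin_cases j <;> simp [sepMatrix]

theorem sepMatrix_add (a b : T) : sepMatrix K (a + b) = sepMatrix K a + sepMatrix K b := by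
  simp [sepMatrix, TensorProduct.add_tmul, TensorProduct.tmul_add]

theorem sepMatrix_sub (a b : T) : sepMatrix K (a - b) = sepMatrix K a - sepMatrix K b := by
  simp [sepMatrix, TensorProduct.sub_tmul, TensorProduct.tmul_sub]

theorem sepMatrix_smul (c : K) (a : T) : sepMatrix K (c • a) = c • sepMatrix K a := by
  simp [sepMatrix, TensorProduct.smul_tmul']

theorem sepMatrix_mul (a b : T) : sepMatrix K (a * b) = sepMatrix K a * sepMatrix K b := by
  simp [sepMatrix]

/-- The commutator of `sepMatrix K a` with the nilpotent matrix has entries `a ⊗ 1` and `-(1 ⊗ a)`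
just above the diagonal, so the top right entry of the alternant is `b ⊗ a - a ⊗ b`. -/
theorem tmul_comm_of_alternant_sepMatrix {a b : T}
    (h : alternant .assoc (sepMatrix K a) (sepMatrix K b) !![0, 1, 0; 0, 0, 1; 0, 0, 0] = 0) :
    a ⊗ₜ[K] b = b ⊗ₜ[K] a := by
  have h1 := congrArg (fun M : Matrix (Fin 3) (Fin 3) (T ⊗[K] T) => M 0 2) h
  simp [alternant, sepMatrix] at h1
  exact neg_add_eq_zero.1 h1

end SepMatrix

/-- The representation separating the two arguments of the alternant. -/
noncomputable def matrixRep (K : Type u) [Field K] : FreeAlgebra K ℕ →ₐ[K]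
    Matrix (Fin 3) (Fin 3) (FreeAlgebra K ℕ ⊗[K] FreeAlgebra K ℕ) :=
  FreeAlgebra.lift K fun n => n.casesOn !![0, 1, 0; 0, 0, 1; 0, 0, 0] fun n =>
    sepMatrix K (FreeAlgebra.ι K n)

theorem mem_span_of_alternant_assoc {u v : FreeAlg .assoc K ℕ} (hv : v ≠ 0)
    (h : alternant .assoc (shift .assoc K u) (shift .assoc K v) (of .assoc K 0) = 0) :
    u ∈ Submodule.span K {v} := by
  have hD (w : FreeAlg .assoc K ℕ) : matrixRep K (assocHom K ℕ (shift .assoc K w)) =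
      sepMatrix K (assocHom K ℕ w) := by
    induction w using induction with
    | of n => simp [shift, assocHom_of, matrixRep]
    | zero => simp [sepMatrix_zero]
    | add p q hp hq => simp [hp, hq, sepMatrix_add]
    | smul c p hp => rw [map_smul, map_smul, map_smul, hp, map_smul, sepMatrix_smul]
    | mul p q hp hq => simp [hp, hq, sepMatrix_mul]
  have h0 : matrixRep K (assocHom K ℕ (of .assoc K 0)) = !![0, 1, 0; 0, 0, 1; 0, 0, 0] := by
    rw [assocHom_of]
    exact FreeAlgebra.lift_ι_apply _ _
  have h1 := congrArg (fun w => matrixRep K (assocHom K ℕ w)) h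
  simp only [map_alternant, hD, h0, map_zero] at h1
  have h2 := mem_span_singleton_of_tmul_comm ((map_ne_zero_iff _ assocHom_injective).2 hv)
    (tmul_comm_of_alternant_sepMatrix h1)
  obtain ⟨c, hc⟩ := Submodule.mem_span_singleton.1 h2
  exact Submodule.mem_span_singleton.2 ⟨c, assocHom_injective (by rw [map_smul, hc])⟩

theorem mem_span_of_alternant_lie {u v : FreeAlg .lie K ℕ} (hv : v ≠ 0)
    (h : alternant .lie (shift .lie K u) (shift .lie K v) (of .lie K 0) = 0) :
    u ∈ Submodule.span K {v} := by
  let ρ : FreeAlg .lie K ℕ →ₙₐ[K] CommutatorRing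
      (Matrix (Fin 3) (Fin 3) (FreeAlgebra K ℕ ⊗[K] FreeAlgebra K ℕ)) :=
    (matrixRep K).toLieHom.toNonUnitalAlgHom.comp (lieHom K ℕ)
  have hof (n : ℕ) : ρ (of .lie K n) = matrixRep K (FreeAlgebra.ι K n) :=
    congrArg (matrixRep K) (lieHom_of n)
  let ℓ : FreeAlg .lie K ℕ → FreeAlgebra K ℕ := lieHom K ℕ
  have hD (w : FreeAlg .lie K ℕ) : ρ (shift .lie K w) = sepMatrix K (ℓ w) := by
    induction w using induction with
    | of n =>
      rw [shift, lift_of, hof]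
      have h1 : matrixRep K (FreeAlgebra.ι K (n + 1)) = sepMatrix K (FreeAlgebra.ι K n) :=
        FreeAlgebra.lift_ι_apply _ _
      exact h1.trans (congrArg (sepMatrix K) (lieHom_of n).symm)
    | zero =>
      rw [map_zero, map_zero]
      exact sepMatrix_zero.symm
    | add p q hp hq =>
      have h1 : ℓ (p + q) = ℓ p + ℓ q := map_add (lieHom K ℕ) p q
      rw [map_add, map_add, hp, hq, h1, sepMatrix_add]
      rfl
    | smul c p hp =>
      have h1 : ℓ (c • p) = c • ℓ p := map_smul (lieHom K ℕ) c p
      rw [map_smul, map_smul, hp, h1, sepMatrix_smul]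
      rfl
    | mul p q hp hq =>
      have h1 : ℓ (p * q) = ℓ p * ℓ q - ℓ q * ℓ p := map_mul (lieHom K ℕ) p q
      rw [map_mul, map_mul, hp, hq, h1, sepMatrix_sub, sepMatrix_mul, sepMatrix_mul]
      rfl
  have h0 : ρ (of .lie K 0) =
      (!![0, 1, 0; 0, 0, 1; 0, 0, 0] :
        Matrix (Fin 3) (Fin 3) (FreeAlgebra K ℕ ⊗[K] FreeAlgebra K ℕ)) := by
    have h1 : matrixRep K (FreeAlgebra.ι K 0) = !![0, 1, 0; 0, 0, 1; 0, 0, 0] :=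
      FreeAlgebra.lift_ι_apply _ _
    exact (hof 0).trans h1
  have h1 := congrArg ρ h
  rw [map_alternant, hD, hD, h0, map_zero] at h1
  -- In a commutator algebra the Lie alternant unfolds to the associative one, so the same matrix
  -- computation applies.
  have h2 := mem_span_singleton_of_tmul_comm (K := K) (u := ℓ u) (v := ℓ v)
    ((map_ne_zero_iff _ lieHom_injective).2 hv) (tmul_comm_of_alternant_sepMatrix h1)
  obtain ⟨c, hc⟩ := Submodule.mem_span_singleton.1 h2
  refine Submodule.mem_span_singleton.2 ⟨c, lieHom_injective ?_⟩
  rw [map_smul]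
  exact hc

/-- The alternant of shifted elements, at a fresh generator, detects linear dependence. -/
theorem mem_span_of_alternant_eq_zero {V : Variety} {u v : FreeAlg V K ℕ} (hv : v ≠ 0)
    (h : alternant V (shift V K u) (shift V K v) (of V K 0) = 0) :
    u ∈ Submodule.span K {v} := by
  cases V with
  | all => exact mem_span_of_alternant_all hv h
  | assoc => exact mem_span_of_alternant_assoc hv h
  | lie => exact mem_span_of_alternant_lie hv h

end FreeAlg

/-! ### Linearly independent evaluations -/

/-- Every integer polynomial that vanishes identically on `A` is zero in the free algebra over
`K`. -/
def NoIntegerIdentity (V : Variety) (K : Type u) [Field K] (A : Type v)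
    [NonUnitalNonAssocRing A] : Prop :=
  ∀ p : IntPoly ℕ, (∀ a : ℕ → A, IntPoly.eval a p = 0) → IntPoly.eval (FreeAlg.of V K) p = 0

section Evaluation

variable {V : Variety} {K : Type u} [Field K] {A : Type v} [NonUnitalNonAssocRing A] [Module K A]
  [IsScalarTower K A A] [SMulCommClass K A A]

/-- The map `Λ` kills the last vector and is independent on the others. A relation expressing the
last vector through them would thus be trivial, making it zero; but then all the alternants would
vanish. -/
theorem linearIndependent_of_alternant (hA : V.Contains A) {n : ℕ} {a : Fin (n + 2) → A} {y : A}
    (h : LinearIndependent K fun i : Fin (n + 1) =>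
      alternant V (a i.castSucc) (a (Fin.last _)) y) : LinearIndependent K a := by
  let Λ := alternantLinear V K (a (Fin.last _)) y
  have hΛ : LinearIndependent K (Λ ∘ Fin.init a) := h
  refine linearIndependent_finSucc'.2 ⟨hΛ.of_comp _, fun hmem => ?_⟩
  have hlast : Λ (a (Fin.last _)) = 0 := alternant_self V hA _ _
  obtain ⟨c, hc⟩ := (Submodule.mem_span_range_iff_exists_fun K).1 hmem
  have h0 : ∀ i, c i = 0 := by
    refine Fintype.linearIndependent_iff.1 hΛ c ?_
    rw [← hlast, ← hc, map_sum]
    simp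
  have h1 : a (Fin.last _) = 0 := by
    rw [← hc]
    simp [h0]
  refine h.ne_zero 0 ?_
  rw [h1, alternant_zero_right]

/-- The kernel of `u ↦ alternant (shift u) (shift v) y` lies in the line through `v`, the last
vector, and this line meets the span of the other vectors only in zero. -/
theorem linearIndependent_alternant_shift {n : ℕ} {p : Fin (n + 2) → FreeAlg V K ℕ}
    (hp : LinearIndependent K p) : LinearIndependent K fun i : Fin (n + 1) =>
      alternant V (FreeAlg.shift V K (p i.castSucc)) (FreeAlg.shift V K (p (Fin.last _)))
        (FreeAlg.of V K 0) := by
  obtain ⟨h1, h2⟩ := linearIndependent_finSucc'.1 hp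
  refine h1.map (f := alternantLinear V K (FreeAlg.shift V K (p (Fin.last _)))
    (FreeAlg.of V K 0) ∘ₗ (FreeAlg.shift V K : FreeAlg V K ℕ →ₗ[K] FreeAlg V K ℕ)) ?_
  rw [Submodule.disjoint_def]
  intro z hz hz'
  obtain ⟨c, rfl⟩ := Submodule.mem_span_singleton.1
    (FreeAlg.mem_span_of_alternant_eq_zero (hp.ne_zero (Fin.last _)) hz')
  by_cases hc : c = 0
  · rw [hc, zero_smul]
  · exact absurd ((Submodule.smul_mem_iff _ hc).1 hz) h2

/-- The endomorphism of integer polynomials that shifts the variables by one. -/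
noncomputable def IntPoly.shift : IntPoly ℕ →ₙₐ[ℤ] IntPoly ℕ :=
  IntPoly.eval fun n => FreeNonUnitalNonAssocAlgebra.of ℤ (n + 1)

theorem IntPoly.eval_shift {B : Type*} [NonUnitalNonAssocRing B] (b : ℕ → B) (p : IntPoly ℕ) :
    IntPoly.eval b (IntPoly.shift p) = IntPoly.eval (fun n => b (n + 1)) p := by
  rw [IntPoly.shift, IntPoly.map_eval]
  simp

/-- Induction on the number of polynomials: alternants of integer polynomials are again integer
polynomials, and there is one fewer of them. A point for the alternants supplies `y` as its
coordinate `0` and the required point as its remaining coordinates. -/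
theorem NoIntegerIdentity.exists_linearIndependent_fin (hA : V.Contains A)
    (h : NoIntegerIdentity V K A) {n : ℕ} {p : Fin (n + 1) → IntPoly ℕ}
    (hp : LinearIndependent K fun i => IntPoly.eval (FreeAlg.of V K) (p i)) :
    ∃ a : ℕ → A, LinearIndependent K fun i => IntPoly.eval a (p i) := by
  induction n with
  | zero =>
    by_contra! hc
    refine hp.ne_zero 0 (h _ fun a => ?_)
    by_contra h0
    exact hc a ((linearIndependent_unique_iff (ι := Fin 1)).2 h0)
  | succ n ih =>
    let q : Fin (n + 1) → IntPoly ℕ := fun i =>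
      alternant V (IntPoly.shift (p i.castSucc)) (IntPoly.shift (p (Fin.last _)))
        (FreeNonUnitalNonAssocAlgebra.of ℤ 0)
    have hshift (r : IntPoly ℕ) : IntPoly.eval (FreeAlg.of V K) (IntPoly.shift r) =
        FreeAlg.shift V K (IntPoly.eval (FreeAlg.of V K) r) := by
      rw [IntPoly.eval_shift, IntPoly.map_eval]
      simp [FreeAlg.shift]
    obtain ⟨a, ha⟩ := ih (p := q) (by
      have h1 := linearIndependent_alternant_shift hp
      simpa only [q, map_alternant, hshift, IntPoly.eval_of] using h1)
    refine ⟨fun n => a (n + 1), linearIndependent_of_alternant hA (y := a 0) ?_⟩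
    simpa only [q, map_alternant, IntPoly.eval_shift, IntPoly.eval_of] using ha

theorem IntPoly.eval_eval_of {X Y B : Type*} [NonUnitalNonAssocRing B] (b : Y → B) (f : X → Y)
    (p : IntPoly X) :
    IntPoly.eval b (IntPoly.eval (fun x => FreeNonUnitalNonAssocAlgebra.of ℤ (f x)) p) =
      IntPoly.eval (fun x => b (f x)) p := by
  simp [IntPoly.map_eval]

/-- If `A` satisfies no integer identity, then finitely many integer polynomials that are linearly
independent in a free algebra have linearly independent values at some point of `A`. -/
theorem NoIntegerIdentity.exists_linearIndependent (hA : V.Contains A)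
    (h : NoIntegerIdentity V K A) {X : Type w} {ι : Type*} [Finite ι] {p : ι → IntPoly X}
    (hp : LinearIndependent K fun i => IntPoly.eval (FreeAlg.of V K) (p i)) :
    ∃ a : X → A, LinearIndependent K fun i => IntPoly.eval a (p i) := by
  classical
  cases isEmpty_or_nonempty ι with
  | inl hι => exact ⟨fun _ => 0, linearIndependent_empty_type⟩
  | inr hι =>
    obtain ⟨n, ⟨e⟩⟩ := Finite.exists_equiv_fin ι
    obtain ⟨n, rfl⟩ : ∃ m, n = m + 1 := Nat.exists_eq_succ_of_ne_zero fun h0 => by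
      subst h0
      exact (e hι.some).elim0
    choose S hS using fun i => IntPoly.exists_finset_eval_congr (FreeAlg V K X) (p i)
    have := Fintype.ofFinite ι
    let T : Finset X := Finset.univ.biUnion S
    -- `f` numbers the finitely many relevant variables and `g` inverts it. The default values `0`
    -- are harmless, since only the variables in `T` affect the values of the `p i`.
    let f : X → ℕ := fun x => if hx : x ∈ T then T.equivFin ⟨x, hx⟩ else 0
    let g : ℕ → FreeAlg V K X := fun n =>
      if hn : n < T.card then FreeAlg.of V K (T.equivFin.symm ⟨n, hn⟩ : X) else 0
    let r : IntPoly X →ₙₐ[ℤ] IntPoly ℕ :=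
      IntPoly.eval fun x => FreeNonUnitalNonAssocAlgebra.of ℤ (f x)
    have hli : LinearIndependent K fun i => IntPoly.eval (FreeAlg.of V K) (r (p i)) := by
      refine LinearIndependent.of_comp
        ((FreeAlg.lift (FreeAlg.contains V K) g : FreeAlg V K ℕ →ₙₐ[K] FreeAlg V K X) :
          FreeAlg V K ℕ →ₗ[K] FreeAlg V K X) ?_
      convert hp using 2 with i
      change FreeAlg.lift (FreeAlg.contains V K) g (IntPoly.eval (FreeAlg.of V K) (r (p i))) = _
      rw [IntPoly.map_eval, IntPoly.eval_eval_of]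
      refine hS i _ _ fun x hx => ?_
      have hx : x ∈ T := Finset.mem_biUnion.2 ⟨i, Finset.mem_univ _, hx⟩
      rw [FreeAlg.lift_of]
      simp [f, g, hx]
    obtain ⟨a, ha⟩ := h.exists_linearIndependent_fin hA (p := fun i => r (p (e.symm i)))
      (hli.comp _ e.symm.injective)
    refine ⟨fun x => a (f x), ?_⟩
    have h1 := ha.comp _ e.injective
    simpa only [Function.comp_def, Equiv.symm_apply_apply, r, IntPoly.eval_eval_of] using h1

end Evaluation

end AlgIdent

namespace AlgIdent

/-! ### Identities with coefficients in the field -/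

section Identities

variable {V : Variety} {K : Type u} [Field K]

variable (V K) in
/-- Every free algebra has a basis of values of integer polynomials. -/
theorem FreeAlg.exists_basis_eval (X : Type w) :
    ∃ (J : Set (FreeAlg V K X)) (q : J → IntPoly X),
      LinearIndependent K (fun j => IntPoly.eval (of V K) (q j)) ∧
      Submodule.span K (Set.range fun j => IntPoly.eval (of V K) (q j)) = ⊤ := by
  obtain ⟨J, hJ, hspan, hli⟩ := exists_linearIndependent K
    (Set.range (IntPoly.eval (of V K) : IntPoly X → FreeAlg V K X))
  choose q hq using fun j : J => hJ j.2
  refine ⟨J, q, ?_, ?_⟩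
  · simpa only [hq] using hli
  · simp only [hq, Subtype.range_coe_subtype, Set.ofPred_mem_eq, hspan, span_range_eval]

theorem FreeAlg.injective_of_linearIndependent {X : Type w} {J B : Type*}
    [NonUnitalNonAssocRing B] [Module K B] {q : J → FreeAlg V K X}
    (hq : Submodule.span K (Set.range q) = ⊤) (f : FreeAlg V K X →ₙₐ[K] B)
    (h : LinearIndependent K fun j => f (q j)) : Function.Injective f := by
  rw [injective_iff_map_eq_zero]
  intro x hx
  have hmem : x ∈ Submodule.span K (Set.range q) := hq ▸ Submodule.mem_top
  obtain ⟨c, rfl⟩ := (Finsupp.mem_span_range_iff_exists_finsupp).1 hmem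
  have hc : c = 0 := by
    refine linearIndependent_iff.1 h c ?_
    rw [← hx, Finsupp.linearCombination_apply, Finsupp.sum, Finsupp.sum, map_sum]
    simp
  simp [hc]

variable {A : Type v} [NonUnitalNonAssocRing A] [Module K A]

theorem NoNontrivialIdentity.noIntegerIdentity (h : NoNontrivialIdentity V K A) :
    NoIntegerIdentity V K A := fun p hp =>
  h _ fun φ => by rw [IntPoly.map_eval, hp]

/-- An identity is a finite combination of basis elements given by integer polynomials. At a point
where these have independent values, its vanishing kills every coefficient. -/
theorem NoIntegerIdentity.noNontrivialIdentity [IsScalarTower K A A] [SMulCommClass K A A]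
    (hA : V.Contains A) (h : NoIntegerIdentity V K A) : NoNontrivialIdentity V K A := by
  intro p hp
  obtain ⟨J, q, hli, hspan⟩ := FreeAlg.exists_basis_eval V K ℕ
  have hmem : p ∈ Submodule.span K (Set.range fun j => IntPoly.eval (FreeAlg.of V K) (q j)) :=
    hspan ▸ Submodule.mem_top
  obtain ⟨c, rfl⟩ := (Finsupp.mem_span_range_iff_exists_finsupp).1 hmem
  obtain ⟨a, ha⟩ := h.exists_linearIndependent hA (p := fun j : c.support => q j)
    (hli.comp _ Subtype.val_injective)
  have h1 := hp (FreeAlg.lift hA a)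
  rw [Finsupp.sum, map_sum, ← Finset.sum_coe_sort] at h1
  simp only [map_smul, IntPoly.map_eval, FreeAlg.lift_of] at h1
  have h2 := Fintype.linearIndependent_iff.1 ha (fun j => c j) h1
  exact Finset.sum_eq_zero fun j hj => by
    dsimp only
    rw [h2 ⟨j, hj⟩, zero_smul]

/-- A family of integer polynomials that spans a free algebra also spans it after an extension of
scalars. -/
theorem FreeAlg.span_eval_eq_top_of_ringHom {L : Type v} [CommRing L] (σ : K →+* L) {X : Type w}
    {J : Type*} {q : J → IntPoly X}
    (hq : Submodule.span K (Set.range fun j => IntPoly.eval (of V K) (q j)) = ⊤) :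
    Submodule.span L (Set.range fun j => IntPoly.eval (of V L) (q j)) = ⊤ := by
  -- Restriction of scalars along `σ` makes the free `L`-algebra a target for the free `K`-algebra.
  let _ : Module K (FreeAlg V L X) := Module.compHom _ σ
  have hsmul (c : K) (x : FreeAlg V L X) : c • x = σ c • x := rfl
  have : IsScalarTower K (FreeAlg V L X) (FreeAlg V L X) :=
    ⟨fun c x y => by simp only [hsmul, smul_eq_mul, smul_mul_assoc]⟩
  have : SMulCommClass K (FreeAlg V L X) (FreeAlg V L X) :=
    ⟨fun c x y => by simp only [hsmul, smul_eq_mul, mul_smul_comm]⟩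
  let ψ : FreeAlg V K X →ₙₐ[K] FreeAlg V L X := lift (contains V L) (of V L)
  have hψ (r : IntPoly X) : ψ (IntPoly.eval (of V K) r) = IntPoly.eval (of V L) r := by
    rw [IntPoly.map_eval]
    simp [ψ]
  rw [eq_top_iff, ← span_range_eval, Submodule.span_le]
  rintro _ ⟨r, rfl⟩
  have hmem : IntPoly.eval (of V K) r ∈
      Submodule.span K (Set.range fun j => IntPoly.eval (of V K) (q j)) :=
    hq ▸ Submodule.mem_top
  obtain ⟨c, hc⟩ := (Finsupp.mem_span_range_iff_exists_finsupp).1 hmem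
  rw [← hψ, ← hc, Finsupp.sum, map_sum]
  refine sum_mem fun j _ => ?_
  rw [map_smul, hψ, hsmul]
  exact Submodule.smul_mem _ _ (Submodule.subset_span ⟨j, rfl⟩)

end Identities

/-! ### Ultrapowers -/

section Ultrapower

open Filter

variable {I : Type*} (U : Ultrafilter I) {K : Type u} [Field K] {A : Type v}
  [NonUnitalNonAssocRing A] [Module K A]

instance germ_isScalarTower [IsScalarTower K A A] :
    IsScalarTower K (Germ (U : Filter I) A) (Germ (U : Filter I) A) :=
  ⟨fun c x y => Germ.inductionOn₂ x y fun x y =>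
    congrArg (fun f : I → A => (f : Germ (U : Filter I) A)) (smul_mul_assoc c x y)⟩

instance germ_smulCommClass [SMulCommClass K A A] :
    SMulCommClass K (Germ (U : Filter I) A) (Germ (U : Filter I) A) :=
  ⟨fun c x y => Germ.inductionOn₂ x y fun x y =>
    congrArg (fun f : I → A => (f : Germ (U : Filter I) A)) (mul_smul_comm c x y).symm⟩

instance germ_isScalarTower' [IsScalarTower K A A] :
    IsScalarTower (Germ (U : Filter I) K) (Germ (U : Filter I) A) (Germ (U : Filter I) A) :=
  ⟨fun c x y => Germ.inductionOn₃ c x y fun c x y =>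
    congrArg (fun f : I → A => (f : Germ (U : Filter I) A))
      (funext fun i => smul_mul_assoc (c i) (x i) (y i))⟩

instance germ_smulCommClass' [SMulCommClass K A A] :
    SMulCommClass (Germ (U : Filter I) K) (Germ (U : Filter I) A) (Germ (U : Filter I) A) :=
  ⟨fun c x y => Germ.inductionOn₃ c x y fun c x y =>
    congrArg (fun f : I → A => (f : Germ (U : Filter I) A))
      (funext fun i => (mul_smul_comm (c i) (x i) (y i)).symm)⟩

theorem Variety.Contains.germ {V : Variety} (hA : V.Contains A) :
    V.Contains (Germ (U : Filter I) A) := by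
  cases V with
  | all => trivial
  | assoc =>
    exact fun x y z => Germ.inductionOn₃ x y z fun x y z =>
      congrArg (fun f : I → A => (f : Germ (U : Filter I) A))
        (funext fun i => hA (x i) (y i) (z i))
  | lie =>
    exact ⟨fun x => Germ.inductionOn x fun x =>
        congrArg (fun f : I → A => (f : Germ (U : Filter I) A)) (funext fun i => hA.1 (x i)),
      fun x y z => Germ.inductionOn₃ x y z fun x y z =>
        congrArg (fun f : I → A => (f : Germ (U : Filter I) A))
          (funext fun i => hA.2 (x i) (y i) (z i))⟩

/-- The projection of a power of a nonassociative ring to its reduced power. -/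
def germHom (A : Type v) [NonUnitalNonAssocRing A] : (I → A) →ₙ+* Germ (U : Filter I) A where
  toFun f := f
  map_zero' := rfl
  map_add' _ _ := rfl
  map_mul' _ _ := rfl

/-- The diagonal embedding of a field in its ultrapower. -/
def germConst (K : Type u) [Field K] : K →+* Germ (U : Filter I) K where
  toFun c := (c : Germ (U : Filter I) K)
  map_zero' := rfl
  map_one' := rfl
  map_add' _ _ := rfl
  map_mul' _ _ := rfl

theorem eval_germ {X : Type w} (a : X → I → A) (p : IntPoly X) :
    IntPoly.eval (fun x => (a x : Germ (U : Filter I) A)) p =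
      ((fun i => IntPoly.eval (fun x => a x i) p : I → A) : Germ (U : Filter I) A) := by
  have h1 : IntPoly.eval a p = fun i => IntPoly.eval (fun x => a x i) p :=
    funext fun i => IntPoly.map_eval (Pi.evalNonUnitalRingHom (fun _ : I => A) i) a p
  rw [← h1]
  exact (IntPoly.map_eval (germHom U A) a p).symm

/-- A finite relation between germs holds at almost every index, and there independence over `K`
makes the representatives of its coefficients vanish. -/
theorem linearIndependent_germ {J : Type*} {x : J → I → A}
    (h : ∀ s : Finset J, ∀ᶠ i in (U : Filter I), LinearIndependent K fun j : s => x j i) :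
    LinearIndependent (Germ (U : Filter I) K) fun j => (x j : Germ (U : Filter I) A) := by
  rw [linearIndependent_iff']
  intro s g hg j hj
  choose G hG using fun j => Quotient.exists_rep (g j)
  have hG (j : J) : ((G j : I → K) : Germ (U : Filter I) K) = g j := hG j
  have hsum : ((∑ j ∈ s, fun i => G j i • x j i : I → A) : Germ (U : Filter I) A) =
      ((0 : I → A) : Germ (U : Filter I) A) := by
    refine Eq.trans ?_ hg
    refine (map_sum (germHom U A) _ _).trans (Finset.sum_congr rfl fun j _ => ?_)
    rw [← hG]
    rfl
  have hj' : ∀ᶠ i in (U : Filter I), G j i = 0 := by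
    filter_upwards [h s, Germ.coe_eq.1 hsum] with i hi hi'
    rw [Finset.sum_apply, ← Finset.sum_coe_sort] at hi'
    exact Fintype.linearIndependent_iff.1 hi (fun j => G j i) hi' ⟨j, hj⟩
  rw [← hG]
  exact Germ.coe_eq.2 hj'

theorem linearIndependent_germ_const {J : Type*} {x : J → Germ (U : Filter I) A}
    (h : LinearIndependent (Germ (U : Filter I) K) x) : LinearIndependent K x := by
  rw [linearIndependent_iff'] at h ⊢
  intro s g hg j hj
  have hsmul (c : K) (y : Germ (U : Filter I) A) : c • y = germConst U K c • y :=
    Germ.inductionOn y fun _ => rfl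
  simp only [hsmul] at hg
  have h1 := h s (fun j => germConst U K (g j)) hg j hj
  exact (map_eq_zero_iff _ (germConst U K).injective).1 h1

end Ultrapower

/-- An ultrafilter on the evaluations at which finitely many given integer polynomials are linearly
independent almost everywhere. -/
theorem exists_ultrafilter_linearIndependent {V : Variety} {K : Type u} [Field K] {A : Type v}
    [NonUnitalNonAssocRing A] [Module K A] [IsScalarTower K A A] [SMulCommClass K A A]
    (hA : V.Contains A) (h : NoIntegerIdentity V K A) {X : Type w} {J : Type*} {q : J → IntPoly X}
    (hq : LinearIndependent K fun j => IntPoly.eval (FreeAlg.of V K) (q j)) :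
    ∃ U : Ultrafilter (X → A), ∀ s : Finset J, ∀ᶠ a in (U : Filter (X → A)),
      LinearIndependent K fun j : s => IntPoly.eval a (q j) := by
  classical
  let D (s : Finset J) : Set (X → A) := {a | LinearIndependent K fun j : s => IntPoly.eval a (q j)}
  have hD {s t : Finset J} (hst : s ⊆ t) : D t ⊆ D s := fun a ha =>
    LinearIndependent.comp ha (fun j : s => (⟨j, hst j.2⟩ : t)) fun i j hij =>
      Subtype.ext (congrArg (fun k : t => k.1) hij)
  have hne (s : Finset J) : (D s).Nonempty :=
    h.exists_linearIndependent hA (hq.comp (fun j : s => j.1) Subtype.val_injective)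
  have hbot : Filter.NeBot (⨅ s, Filter.principal (D s)) := by
    refine Filter.iInf_neBot_of_directed ?_ fun s => Filter.principal_neBot_iff.2 (hne s)
    exact fun s t => ⟨s ∪ t, Filter.principal_mono.2 (hD Finset.subset_union_left),
      Filter.principal_mono.2 (hD Finset.subset_union_right)⟩
  exact ⟨Ultrafilter.of _, fun s => Ultrafilter.of_le _
    (Filter.mem_iInf_of_mem s (Filter.mem_principal_self _))⟩

section Embeddings

variable {V : Variety} {K : Type u} [Field K] {A : Type v} [NonUnitalNonAssocRing A] [Module K A]
  [IsScalarTower K A A] [SMulCommClass K A A]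

theorem NoIntegerIdentity.exists_embeddings (hA : V.Contains A) (h : NoIntegerIdentity V K A)
    (X : Type w) : ∃ U : Ultrafilter (X → A),
      (∃ f : FreeAlg V K X →ₙₐ[K] Filter.Germ (U : Filter (X → A)) A, Function.Injective f) ∧
      ∃ f : FreeAlg V (Filter.Germ (U : Filter (X → A)) K) X
        →ₙₐ[Filter.Germ (U : Filter (X → A)) K] Filter.Germ (U : Filter (X → A)) A,
        Function.Injective f := by
  obtain ⟨J, q, hli, hspan⟩ := FreeAlg.exists_basis_eval V K X
  obtain ⟨U, hU⟩ := exists_ultrafilter_linearIndependent hA h hli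
  -- The germs of the coordinate functions form a generic point: evaluating at it records the values
  -- at almost all points of `A^X`.
  let g : X → Filter.Germ (U : Filter (X → A)) A := fun x => ((fun a => a x : (X → A) → A) : _)
  have hg : LinearIndependent (Filter.Germ (U : Filter (X → A)) K)
      fun j => IntPoly.eval g (q j) := by
    simp only [g, eval_germ]
    exact linearIndependent_germ U hU
  refine ⟨U, ⟨FreeAlg.lift (hA.germ U) g, ?_⟩, ⟨FreeAlg.lift (hA.germ U) g, ?_⟩⟩
  · refine FreeAlg.injective_of_linearIndependent hspan _ ?_
    simp only [IntPoly.map_eval, FreeAlg.lift_of]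
    exact linearIndependent_germ_const U hg
  · refine FreeAlg.injective_of_linearIndependent
      (FreeAlg.span_eval_eq_top_of_ringHom (germConst U K) hspan) _ ?_
    simp only [IntPoly.map_eval, FreeAlg.lift_of]
    exact hg

end Embeddings

end AlgIdent

namespace AlgIdent

/-! ### The theorem of Łoś for pairs of a field and an algebra -/

section Los

open Filter

variable {I : Type*} (U : Ultrafilter I) {K : Type u} [Field K] {A : Type v}
  [NonUnitalNonAssocRing A] [Module K A]

theorem ScalarTerm.eval_germ {m : ℕ} (t : ScalarTerm m) (a : Fin m → I → K) :
    t.eval (fun k => (a k : Germ (U : Filter I) K)) =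
      ((fun i => t.eval fun k => a k i : I → K) : Germ (U : Filter I) K) := by
  induction t with
  | var i => rfl
  | zero => rfl
  | one => rfl
  | add s t hs ht => rw [ScalarTerm.eval, hs, ht]; rfl
  | neg t ht => rw [ScalarTerm.eval, ht]; rfl
  | mul s t hs ht => rw [ScalarTerm.eval, hs, ht]; rfl

theorem VectorTerm.eval_germ {m n : ℕ} (t : VectorTerm m n) (a : Fin m → I → K)
    (x : Fin n → I → A) :
    t.eval (fun k => (a k : Germ (U : Filter I) K)) (fun k => (x k : Germ (U : Filter I) A)) =
      ((fun i => t.eval (fun k => a k i) fun k => x k i : I → A) : Germ (U : Filter I) A) := by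
  induction t with
  | var i => rfl
  | zero => rfl
  | add s t hs ht => rw [VectorTerm.eval, hs, ht]; rfl
  | neg t ht => rw [VectorTerm.eval, ht]; rfl
  | mul s t hs ht => rw [VectorTerm.eval, hs, ht]; rfl
  | smul c t ht => rw [VectorTerm.eval, ht, ScalarTerm.eval_germ]; rfl

/-- The quantifier step in the theorem of Łoś: the test function picks a counterexample at each
index that has one. -/
theorem forall_germ_eventually_iff {B : Type*} [Nonempty B] {P : I → B → Prop} :
    (∀ f : I → B, ∀ᶠ i in (U : Filter I), P i (f i)) ↔ ∀ᶠ i in (U : Filter I), ∀ y, P i y := by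
  classical
  refine ⟨fun h => ?_, fun h f => h.mono fun i hi => hi _⟩
  refine (h fun i => if hi : ∃ y, ¬P i y then hi.choose else Classical.arbitrary B).mono
    fun i hi y => ?_
  by_contra hy
  have hex : ∃ y, ¬P i y := ⟨y, hy⟩
  rw [dif_pos hex] at hi
  exact hex.choose_spec hi

theorem snoc_germ {B : Type*} {n : ℕ} (x : Fin n → I → B) (y : I → B) :
    (Fin.snoc (fun k => (x k : Germ (U : Filter I) B)) (y : Germ (U : Filter I) B) :
      Fin (n + 1) → Germ (U : Filter I) B) =
      fun k => ((Fin.snoc x y : Fin (n + 1) → I → B) k : Germ (U : Filter I) B) := by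
  funext k
  refine Fin.lastCases ?_ (fun k => ?_) k <;> simp

theorem snoc_apply_apply {B : Type*} {n : ℕ} (x : Fin n → I → B) (y : I → B) (i : I) :
    (fun k => (Fin.snoc x y : Fin (n + 1) → I → B) k i) =
      (Fin.snoc (fun k => x k i) (y i) : Fin (n + 1) → B) := by
  funext k
  refine Fin.lastCases ?_ (fun k => ?_) k <;> simp

theorem TwoSortedFormula.realize_germ {m n : ℕ} (φ : TwoSortedFormula m n) (a : Fin m → I → K)
    (x : Fin n → I → A) :
    φ.Realize (fun k => (a k : Germ (U : Filter I) K)) (fun k => (x k : Germ (U : Filter I) A)) ↔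
      ∀ᶠ i in (U : Filter I), φ.Realize (fun k => a k i) fun k => x k i := by
  induction φ with
  | eqScalar s t =>
    rw [Realize, ScalarTerm.eval_germ, ScalarTerm.eval_germ]
    exact Germ.coe_eq
  | eqVector s t =>
    rw [Realize, VectorTerm.eval_germ, VectorTerm.eval_germ]
    exact Germ.coe_eq
  | falsum => simp only [Realize, eventually_const]
  | imp φ ψ hφ hψ => simp only [Realize, hφ, hψ, Ultrafilter.eventually_imp]
  | allScalar φ ih =>
    simp only [Realize]
    rw [← forall_germ_eventually_iff]
    refine ⟨fun h c => ?_, fun h c => Germ.inductionOn c fun c => ?_⟩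
    · have h1 := h c
      rw [snoc_germ, ih] at h1
      simpa only [snoc_apply_apply] using h1
    · rw [snoc_germ, ih]
      simpa only [snoc_apply_apply] using h c
  | allVector φ ih =>
    simp only [Realize]
    rw [← forall_germ_eventually_iff]
    refine ⟨fun h c => ?_, fun h c => Germ.inductionOn c fun c => ?_⟩
    · have h1 := h c
      rw [snoc_germ, ih] at h1
      simpa only [snoc_apply_apply] using h1
    · rw [snoc_germ, ih]
      simpa only [snoc_apply_apply] using h c

theorem elementarilyEquivalent_germ :
    ElementarilyEquivalent K A (Germ (U : Filter I) K) (Germ (U : Filter I) A) := by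
  intro φ
  have h := φ.realize_germ U (Fin.elim0 : Fin 0 → I → K) (Fin.elim0 : Fin 0 → I → A)
  simp only [Subsingleton.elim (fun k : Fin 0 => _) (Fin.elim0 : Fin 0 → _)] at h
  rw [h, eventually_const]

end Los

/-! ### Sentences expressing integer identities -/

/-- The universal closure of a formula without free scalar variables. -/
def TwoSortedFormula.closeVectors : {n : ℕ} → TwoSortedFormula 0 n → TwoSortedFormula 0 0
  | 0, φ => φ
  | _ + 1, φ => closeVectors (.allVector φ)

section Transfer

variable {K : Type*} [Field K] {A : Type*} [NonUnitalNonAssocRing A] [Module K A]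
  {L : Type*} [Field L] {B : Type*} [NonUnitalNonAssocRing B] [Module L B]

theorem TwoSortedFormula.realize_closeVectors {n : ℕ} (φ : TwoSortedFormula 0 n) :
    φ.closeVectors.Realize (Fin.elim0 : Fin 0 → K) (Fin.elim0 : Fin 0 → A) ↔
      ∀ x : Fin n → A, φ.Realize (Fin.elim0 : Fin 0 → K) x := by
  induction n with
  | zero => exact ⟨fun h x => Subsingleton.elim Fin.elim0 x ▸ h, fun h => h _⟩
  | succ n ih =>
    rw [closeVectors, ih]
    refine ⟨fun h x => ?_, fun h x y => h _⟩
    have h1 := h (Fin.init x) (x (Fin.last n))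
    rwa [Fin.snoc_init_self] at h1

-- One term must serve both pairs, so that it can occur in a single sentence. All large `n` are
-- allowed so that two terms can be brought to a common number of variables.
variable (K A L B) in
theorem IntPoly.exists_vectorTerm (p : IntPoly ℕ) : ∃ N, ∀ n ≥ N, ∃ τ : VectorTerm 0 n,
    (∀ a : ℕ → A, τ.eval (Fin.elim0 : Fin 0 → K) (fun k => a k) = IntPoly.eval a p) ∧
      ∀ b : ℕ → B, τ.eval (Fin.elim0 : Fin 0 → L) (fun k => b k) = IntPoly.eval b p := by
  induction p using IntPoly.induction with
  | of x =>
    exact ⟨x + 1, fun n hn => ⟨.var ⟨x, hn⟩, fun a => by simp [VectorTerm.eval],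
      fun b => by simp [VectorTerm.eval]⟩⟩
  | zero =>
    exact ⟨0, fun n _ => ⟨.zero, fun a => by simp [VectorTerm.eval],
      fun b => by simp [VectorTerm.eval]⟩⟩
  | add p q hp hq =>
    obtain ⟨M, hM⟩ := hp
    obtain ⟨N, hN⟩ := hq
    refine ⟨max M N, fun n hn => ?_⟩
    obtain ⟨σ, hσ, hσ'⟩ := hM n (le_trans (le_max_left _ _) hn)
    obtain ⟨τ, hτ, hτ'⟩ := hN n (le_trans (le_max_right _ _) hn)
    exact ⟨.add σ τ, fun a => by rw [VectorTerm.eval, hσ, hτ, map_add],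
      fun b => by rw [VectorTerm.eval, hσ', hτ', map_add]⟩
  | neg p hp =>
    obtain ⟨M, hM⟩ := hp
    refine ⟨M, fun n hn => ?_⟩
    obtain ⟨σ, hσ, hσ'⟩ := hM n hn
    exact ⟨.neg σ, fun a => by rw [VectorTerm.eval, hσ, map_neg],
      fun b => by rw [VectorTerm.eval, hσ', map_neg]⟩
  | mul p q hp hq =>
    obtain ⟨M, hM⟩ := hp
    obtain ⟨N, hN⟩ := hq
    refine ⟨max M N, fun n hn => ?_⟩
    obtain ⟨σ, hσ, hσ'⟩ := hM n (le_trans (le_max_left _ _) hn)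
    obtain ⟨τ, hτ, hτ'⟩ := hN n (le_trans (le_max_right _ _) hn)
    exact ⟨.mul σ τ, fun a => by rw [VectorTerm.eval, hσ, hτ, map_mul],
      fun b => by rw [VectorTerm.eval, hσ', hτ', map_mul]⟩

theorem ElementarilyEquivalent.eval_eq_zero (h : ElementarilyEquivalent K A L B) {p : IntPoly ℕ}
    (hp : ∀ a : ℕ → A, IntPoly.eval a p = 0) (b : ℕ → B) : IntPoly.eval b p = 0 := by
  obtain ⟨n, hn⟩ := IntPoly.exists_vectorTerm K A L B p
  obtain ⟨τ, hA, hB⟩ := hn n le_rfl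
  have h1 := h (TwoSortedFormula.eqVector τ .zero).closeVectors
  rw [TwoSortedFormula.realize_closeVectors, TwoSortedFormula.realize_closeVectors] at h1
  rw [← hB]
  refine h1.1 (fun x => ?_) _
  -- The term sees only the first `n` variables, so the assignment may be padded with zeros.
  have h2 := hA fun k => if hk : k < n then x ⟨k, hk⟩ else 0
  rw [hp] at h2
  simpa [TwoSortedFormula.Realize, VectorTerm.eval] using h2

variable (K L) in
theorem exists_scalarTerm_natCast (n : ℕ) : ∃ τ : ScalarTerm 0,
    τ.eval (Fin.elim0 : Fin 0 → K) = n ∧ τ.eval (Fin.elim0 : Fin 0 → L) = n := by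
  induction n with
  | zero => exact ⟨.zero, by simp [ScalarTerm.eval], by simp [ScalarTerm.eval]⟩
  | succ n ih =>
    obtain ⟨τ, h1, h2⟩ := ih
    exact ⟨.add τ .one, by simp [ScalarTerm.eval, h1], by simp [ScalarTerm.eval, h2]⟩

theorem ElementarilyEquivalent.intCast_eq_zero_iff (h : ElementarilyEquivalent K A L B) (n : ℤ) :
    (n : K) = 0 ↔ (n : L) = 0 := by
  have hnat (n : ℕ) : (n : K) = 0 ↔ (n : L) = 0 := by
    obtain ⟨τ, h1, h2⟩ := exists_scalarTerm_natCast K L n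
    have h3 := h (.eqScalar τ .zero)
    rwa [TwoSortedFormula.Realize, TwoSortedFormula.Realize, h1, h2] at h3
  obtain ⟨m, rfl | rfl⟩ := n.eq_nat_or_neg <;> simp [hnat]

end Transfer

/-- An integer identity of a ring in which a free algebra embeds is trivial. -/
theorem FreeAlg.eval_of_eq_zero_of_injective {V : Variety} {L : Type u} [Field L] {B F : Type*}
    [NonUnitalNonAssocRing B] [FunLike F (FreeAlg V L (ULift.{w} ℕ)) B]
    [NonUnitalRingHomClass F (FreeAlg V L (ULift.{w} ℕ)) B] (f : F) (hf : Function.Injective f)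
    {p : IntPoly ℕ} (hp : ∀ b : ℕ → B, IntPoly.eval b p = 0) :
    IntPoly.eval (of V L) p = 0 := by
  have h1 : IntPoly.eval (fun n => of V L (ULift.up.{w} n)) p = 0 :=
    hf (by rw [IntPoly.map_eval, hp, map_zero])
  have h2 := IntPoly.map_eval (lift (contains V L) fun n : ULift.{w} ℕ => of V L n.down)
    (fun n => of V L (ULift.up.{w} n)) p
  rw [h1, map_zero] at h2
  simpa using h2.symm

end AlgIdent

/-- For an algebra `A` over a field `K` in the variety of all, of associative or of Lie algebras,
the following are equivalent:
* `A` satisfies no nontrivial identity;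
* every free `K`-algebra embeds, as a `K`-algebra, in an ultrapower of `A`;
* every free algebra over the ultrapower of `K` embeds, as an algebra over the ultrapower of `K`,
  in the ultrapower of `A`, for some ultrafilter;
* every free `K`-algebra embeds, along some embedding of `K` in a field `L`, in an `L`-algebra
  elementarily equivalent to the `K`-algebra `A`;
* for every set of generators there is an `L`-algebra elementarily equivalent to the
  `K`-algebra `A` in which the free `L`-algebra on this set embeds as an `L`-algebra. -/
theorem mainTheorem3 (V : Variety) (K : Type u) [Field K] (A : Type v) [NonUnitalNonAssocRing A]
    [Module K A] [IsScalarTower K A A] [SMulCommClass K A A] (hA : V.Contains A) :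
    List.TFAE [
      NoNontrivialIdentity V K A,
      ∀ X : Type w, ∃ (I : Type (max v w)) (U : Ultrafilter I)
        (f : FreeAlg V K X →ₙₐ[K] Filter.Germ (U : Filter I) A),
        Function.Injective f,
      ∀ X : Type w, ∃ (I : Type (max v w)) (U : Ultrafilter I)
        (f : FreeAlg V (Filter.Germ (U : Filter I) K) X →ₙₐ[Filter.Germ (U : Filter I) K]
          Filter.Germ (U : Filter I) A),
        Function.Injective f,
      ∀ X : Type w, ∃ (L : Type (max u v w)) (_ : Field L) (B : Type (max v w))
        (_ : NonUnitalNonAssocRing B) (_ : Module L B) (_ : IsScalarTower L B B)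
        (_ : SMulCommClass L B B) (σ : K →+* L)
        (f : FreeAlg V K X →ₛₙₐ[(σ : K →* L)] B),
        ElementarilyEquivalent K A L B ∧ Function.Injective f,
      ∀ X : Type w, ∃ (L : Type (max u v w)) (_ : Field L) (B : Type (max v w))
        (_ : NonUnitalNonAssocRing B) (_ : Module L B) (_ : IsScalarTower L B B)
        (_ : SMulCommClass L B B) (f : FreeAlg V L X →ₙₐ[L] B),
        ElementarilyEquivalent K A L B ∧ Function.Injective f] := by
  tfae_have 1 → 2 := fun h X => by
    obtain ⟨U, ⟨f, hf⟩, -⟩ := h.noIntegerIdentity.exists_embeddings hA X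
    exact ⟨X → A, U, f, hf⟩
  tfae_have 1 → 3 := fun h X => by
    obtain ⟨U, -, f, hf⟩ := h.noIntegerIdentity.exists_embeddings hA X
    exact ⟨X → A, U, f, hf⟩
  tfae_have 2 → 4 := fun h X => by
    obtain ⟨I, U, f, hf⟩ := h X
    refine ⟨Filter.Germ (U : Filter I) K, inferInstance, Filter.Germ (U : Filter I) A,
      inferInstance, inferInstance, inferInstance, inferInstance, germConst U K,
      { toFun := f
        map_smul' := fun c x => (map_smul f c x).trans
          (Filter.Germ.inductionOn (f x) fun _ => rfl)
        map_zero' := map_zero f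
        map_add' := map_add f
        map_mul' := map_mul f }, elementarilyEquivalent_germ U, hf⟩
  tfae_have 3 → 5 := fun h X => by
    obtain ⟨I, U, f, hf⟩ := h X
    exact ⟨Filter.Germ (U : Filter I) K, inferInstance, Filter.Germ (U : Filter I) A,
      inferInstance, inferInstance, inferInstance, inferInstance, f,
      elementarilyEquivalent_germ U, hf⟩
  tfae_have 4 → 1 := fun h => by
    obtain ⟨L, _, B, _, _, _, _, σ, f, hB, hf⟩ := h (ULift.{w} ℕ)
    -- The embedded free algebra is already over `K`, and only its ring structure matters, so `σ`
    -- plays no role here.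
    exact NoIntegerIdentity.noNontrivialIdentity hA fun p hp =>
      FreeAlg.eval_of_eq_zero_of_injective f hf (hB.eval_eq_zero hp)
  tfae_have 5 → 1 := fun h => by
    obtain ⟨L, _, B, _, _, _, _, f, hB, hf⟩ := h (ULift.{w} ℕ)
    refine NoIntegerIdentity.noNontrivialIdentity hA fun p hp => ?_
    have h1 := FreeAlg.eval_of_eq_zero_of_injective f hf (hB.eval_eq_zero hp)
    -- The polynomial is known to vanish over `L`. Its integer coefficients then vanish in `K` too,
    -- because sentences detect the characteristic.
    rw [FreeAlg.eval_of_eq_zero_iff] at h1 ⊢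
    exact fun g => (hB.intCast_eq_zero_iff _).2 (h1 g)
  tfae_finish
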